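/- **Model.** An entanglement generation switch has $C\in\mathbb N$ resources and serves nodes $1,\dots,K$; node $k$ has $c_k\in\mathbb N$ communication qubits. A flow $f\in\mathcal F$ is a pair of distinct nodes together with one of $T$ session types. A session of flow $f$ is a finite sequence of periods, each *active* or *idle*, the first and the last being active. Each period is Coxian: it consists of finitely many exponential phases; on leaving phase $i$ of rate $\mu_i^f>0$ the session moves to the next phase of the same period with a given probability and otherwise completes the period (always, from the last phase of the period). A completed period is followed by the next period, and the session ends only at the end of its last period, apart from the blocking described next. A session in an active period engages one switch resource; a session in any period, active or idle, occupies one communication qubit at each of its two nodes. Let $x_i^f$ be the number of sessions of flow $f$ in phase $i$, $e_i^f$ the unit vectors, and $$\mathcal S''=\Big\{\mathbf x:\ \sum_f\sum_{i\text{ active}}x_i^f\le C,\ \ \sum_{f\ni k}\sum_i x_i^f\le c_k\ \ \forall k\Big\}.$$ Sessions of flow $f$ are requested at rate $\nu^f\ge0$, independently and as Poisson processes, while both nodes of $f$ have an unoccupied qubit. A session needs a resource at its beginning and whenever it completes an idle period that is followed by an active one. If all $C$ resources are then engaged, it jumps over that active period and all active periods directly following it, to the beginning of the next idle period, or ends if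 there is none (jump-over blocking). These rules define a continuous-time Markov chain on the finite set $\mathcal S''$. Let $\gamma_i^f$ be the probability that a session of flow $f$ that is never blocked reaches phase $i$, and $\rho_i^f=\nu^f\gamma_i^f/\mu_i^f$. **Theorem.** 1. The chain has exactly one stationary distribution, namely $$\pi(\mathbf x)=\Big(\sum_{\mathbf y\in\mathcal S''}\prod_{f}\prod_i\frac{(\rho_i^f)^{y_i^f}}{y_i^f!}\Big)^{-1}\prod_f\prod_i\frac{(\rho_i^f)^{x_i^f}}{x_i^f!},\qquad \mathbf x\in\mathcal S''.$$ 2. The arrival rates are state-independent: the rates $\lambda_i^f(\mathbf x)=\nu^f\gamma_i^f$ if $\mathbf x+e_i^f\in\mathcal S''$, and $\lambda_i^f(\mathbf x)=0$ otherwise, satisfy for all $\mathbf x\in\mathcal S''$ the traffic equations $\lambda_i^f(\mathbf x)=\nu_i^f(\mathbf x)+\sum_j\lambda_j^f(\mathbf x)\,p^f_{j,i}(\mathbf x)$, where $\nu_i^f(\mathbf x)$ is the rate of external arrivals into phase $i$ in state $\mathbf x$ and $p_{j,i}^f(\mathbf x)$ is the state-dependent probability that a session leaving phase $j$ moves to phase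 $i$ when the other sessions are in state $\mathbf x$. In stationarity, the total rate of (external and internal) arrivals into phase $i$ of flow $f$ that find the other sessions in state $\mathbf x$ is $\pi(\mathbf x)\lambda_i^f(\mathbf x)$. 3. Let $f$ be a flow with $\nu^f>0$ both of whose nodes have at least one qubit. For every active period of a session of flow $f$ (the first one, one that follows an idle period, or one that follows another active period), let its blocking probability be the stationary rate at which sessions jump over it, divided by the sum of this rate and the (stationary) rate at which sessions enter it; the denominator is positive. The blocking probability is the same for all these periods. It equals the conditional probability under $\pi$ that all $C$ resources are engaged given that both nodes of $f$ have an unoccupied qubit, and is given by $$\Big(\sum_{\mathbf q\in\mathcal Q'(f)}\ \prod_{j}\frac{(\rho^{j})^{q_j}}{q_j!}\Big)^{-1}\sum_{\mathbf q\in\mathcal Q(C)\cap\mathcal Q'(f)}\ \prod_{j}\frac{(\rho^{j})^{q_j}}{q_j!}.$$ Here $j$ runs through the pairs $(g,\mathrm{A})$, $(g,\mathrm{I})$ with $g\in\mathcal F$; $\rho^{(g,\mathrm A)}$ and $\rho^{(g,\mathrm I)}$ are the sums of $\rho_i^g$ over the phases $i$ of the active and of the idle periods of $g$; $\mathcal Q'(f)$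 is the set of vectors $\mathbf q$ of non-negative integers with $\sum_g q_{(g,\mathrm A)}\le C$ and $\sum_{g\ni k}(q_{(g,\mathrm A)}+q_{(g,\mathrm I)})\le c_k$ for all $k$, with strict inequality for the two nodes $k$ of $f$; and $\mathcal Q(C)$ is the set of those with $\sum_g q_{(g,\mathrm A)}=C$. -/

import Mathlib

/-- Flows: an unordered pair of distinct nodes (listed increasingly) and a session type. -/
abbrev SessionFlow (K T : ℕ) := {p : Fin K × Fin K // p.1 < p.2} × Fin T

/-- Node `k` partakes in flow `f`. -/
abbrev SessionFlow.Uses {K T : ℕ} (f : SessionFlow K T) (k : Fin K) : Prop :=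
  k = f.1.1.1 ∨ k = f.1.1.2

/-- Active periods hold a switch resource, idle periods do not. -/
inductive PeriodKind
  | active
  | idle
  deriving DecidableEq

instance : Fintype PeriodKind :=
  ⟨{.active, .idle}, fun a => by cases a <;> simp⟩

/-- The structure of a session: finitely many periods, numbered `0, …, lastPeriod`, the first and
the last of which are active; period `m` is Coxian with phases `0, …, lastPhase m`.  On leaving
phase `i` of period `m` the session moves to the next phase of that period with probability
`cont m i`, and otherwise completes the period; `μ m i` is the rate of the exponential phase. -/
structure SessionStructure where
  lastPeriod : ℕ
  kind : Fin (lastPeriod + 1) → PeriodKind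
  kind_first : kind 0 = .active
  kind_last : kind (Fin.last lastPeriod) = .active
  lastPhase : Fin (lastPeriod + 1) → ℕ
  cont : (m : Fin (lastPeriod + 1)) → Fin (lastPhase m + 1) → ℝ
  cont_nonneg : ∀ m i, 0 ≤ cont m i
  cont_le_one : ∀ m i, cont m i ≤ 1
  cont_last : ∀ m, cont m (Fin.last (lastPhase m)) = 0
  μ : (m : Fin (lastPeriod + 1)) → Fin (lastPhase m + 1) → ℝ
  μ_pos : ∀ m i, 0 < μ m i

namespace SessionStructure

variable (s : SessionStructure)

abbrev Period := Fin (s.lastPeriod + 1)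

/-- The phases of all periods: the queues of the flow. -/
abbrev Phase := (m : s.Period) × Fin (s.lastPhase m + 1)

/-- The first phase of a period. -/
def start (m : s.Period) : s.Phase := ⟨m, 0⟩

/-- The phase that follows within the same period, if any. -/
def nextPhase (i : s.Phase) : Option s.Phase :=
  if h : (i.2 : ℕ) < s.lastPhase i.1 then some ⟨i.1, ⟨i.2 + 1, by omega⟩⟩ else none

/-- The period that follows, if any. -/
def nextPeriod (m : s.Period) : Option s.Period :=
  if h : (m : ℕ) < s.lastPeriod then some ⟨m + 1, by omega⟩ else none

/-- The first idle period after period `m`, if any. -/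
def nextIdle (m : s.Period) : Option s.Period :=
  if h : (Finset.univ.filter fun n : s.Period => m < n ∧ s.kind n = .idle).Nonempty then
    some (Finset.min' _ h) else none

/-- The transition probabilities `p_{i,j}` of a session in the absence of blocking; the
destination `none` means that the session ends. -/
noncomputable def route (i : s.Phase) (j : Option s.Phase) : ℝ :=
  (if s.nextPhase i = j then s.cont i.1 i.2 else 0) +
    (if (s.nextPeriod i.1).map s.start = j then 1 - s.cont i.1 i.2 else 0)

/-- The probability that a session without blocking, now in phase `j`, is in phase `i` now or after
at most `n` transitions. -/
noncomputable def hitWithin (i : s.Phase) : ℕ → s.Phase → ℝ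
  | 0, j => if j = i then 1 else 0
  | n + 1, j => if j = i then 1 else ∑ k, s.route j (some k) * hitWithin i n k

/-- `γ_i`, the probability of reaching phase `i` from the first phase of the session.  A session
never visits a phase twice, so that the number of phases bounds the number of transitions. -/
noncomputable def reachProb (i : s.Phase) : ℝ :=
  s.hitWithin i (Fintype.card s.Phase) (s.start 0)

/-- Periods `b, …, m` are all active, with `b ≤ m`: a session that is refused a resource at the
beginning of period `b` jumps over period `m`. -/
def ActiveRun (b m : s.Period) : Prop :=
  b ≤ m ∧ ∀ l, b ≤ l → l ≤ m → s.kind l = .active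

end SessionStructure

/-- An entanglement generation switch with `C` resources and `K` nodes, node `k` having `c k`
communication qubits; sessions of flow `f` are requested at rate `ν f`. -/
structure EGS (K T : ℕ) where
  C : ℕ
  c : Fin K → ℕ
  session : SessionFlow K T → SessionStructure
  ν : SessionFlow K T → ℝ
  ν_nonneg : ∀ f, 0 ≤ ν f

namespace EGS

variable {K T : ℕ} (M : EGS K T)

/-- `x f i` is the number of sessions of flow `f` in phase `i`. -/
abbrev State := (f : SessionFlow K T) → (M.session f).Phase → ℕ

/-- The unit vector `e_i^f`. -/
def e (f : SessionFlow K T) (i : (M.session f).Phase) : M.State := Pi.single f (Pi.single i 1)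

/-- The number of engaged switch resources: sessions that are in an active period. -/
def engaged (x : M.State) : ℕ :=
  ∑ f, ∑ i : (M.session f).Phase, if (M.session f).kind i.1 = .active then x f i else 0

/-- The number of occupied communication qubits of node `k`: sessions, active or idle, of the
flows that involve `k`. -/
def qubits (x : M.State) (k : Fin K) : ℕ :=
  ∑ f : SessionFlow K T, if f.Uses k then ∑ i, x f i else 0

/-- The state space `S''`. -/
def states : Set M.State := {x | M.engaged x ≤ M.C ∧ ∀ k, M.qubits x k ≤ M.c k}

theorem states_finite : M.states.Finite := by
  refine (Set.finite_Iic (fun f _ => M.c f.1.1.1 : M.State)).subset ?_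
  intro x hx f i
  have h := hx.2 f.1.1.1
  refine le_trans ?_ h
  calc x f i ≤ ∑ j, x f j :=
        Finset.single_le_sum (f := fun j => x f j) (fun _ _ => Nat.zero_le _) (Finset.mem_univ i)
    _ = (if f.Uses f.1.1.1 then ∑ j, x f j else 0) := by simp [SessionFlow.Uses]
    _ ≤ M.qubits x f.1.1.1 :=
        Finset.single_le_sum (f := fun g : SessionFlow K T => if g.Uses f.1.1.1 then ∑ j, x g j else 0)
          (fun _ _ => Nat.zero_le _) (Finset.mem_univ f)

/-- The state space as a finite set. -/
noncomputable def S : Finset M.State := M.states_finite.toFinset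

theorem mem_S (x : M.State) :
    x ∈ M.S ↔ M.engaged x ≤ M.C ∧ ∀ k, M.qubits x k ≤ M.c k := by
  simp [S, states]

/-- Both nodes of flow `f` have an unoccupied communication qubit. -/
def HasQubits (f : SessionFlow K T) (x : M.State) : Prop := ∀ k, f.Uses k → M.qubits x k < M.c k

/-! Dynamics.  In what follows `z` is the state of the network without the session that moves. -/

/-- A session of flow `f` that has completed period `m` is refused a resource for period `n`:
it has to obtain one since `m` is idle and `n` is active, but it cannot be admitted. -/
def Refused (f : SessionFlow K T) (z : M.State) (m n : (M.session f).Period) : Prop :=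
  (M.session f).kind m = .idle ∧ (M.session f).kind n = .active ∧
    z + M.e f ((M.session f).start n) ∉ M.S

open Classical in
/-- The destination of a session of flow `f` that completes period `m`: the next period; or, if
refused a resource there, the next idle period; `none` if there is no such period. -/
noncomputable def afterPeriod (f : SessionFlow K T) (z : M.State) (m : (M.session f).Period) :
    Option (M.session f).Phase :=
  match (M.session f).nextPeriod m with
  | none => none
  | some n =>
    if M.Refused f z m n then ((M.session f).nextIdle n).map (M.session f).start
    else some ((M.session f).start n)

/-- The state-dependent transition probabilities `p_{i,j}`; the destination `none` means that the
session ends. -/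
noncomputable def routeAt (f : SessionFlow K T) (z : M.State) (i : (M.session f).Phase)
    (j : Option (M.session f).Phase) : ℝ :=
  (if (M.session f).nextPhase i = j then (M.session f).cont i.1 i.2 else 0) +
    (if M.afterPeriod f z i.1 = j then 1 - (M.session f).cont i.1 i.2 else 0)

open Classical in
/-- The phase that a newly requested session of flow `f` enters when the network is in state `z`:
if its nodes have free qubits (otherwise no request is made), the first phase of the session when
a resource is free, and else the first idle period; `none` if no session is started. -/
noncomputable def entry (f : SessionFlow K T) (z : M.State) : Option (M.session f).Phase :=
  if M.HasQubits f z then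
    if z + M.e f ((M.session f).start 0) ∈ M.S then some ((M.session f).start 0)
    else ((M.session f).nextIdle 0).map (M.session f).start
  else none

/-- The rate of external arrivals into phase `i` of flow `f` in state `z`. -/
noncomputable def externalRate (f : SessionFlow K T) (z : M.State) (i : (M.session f).Phase) : ℝ :=
  if M.entry f z = some i then M.ν f else 0

/-- `z` with a session of flow `f` added in phase `j`, if any. -/
def place (f : SessionFlow K T) (z : M.State) : Option (M.session f).Phase → M.State
  | none => z
  | some j => z + M.e f j

open Classical in
/-- The transition rate from state `x` to state `y ≠ x`; phases are infinite-server queues. -/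
noncomputable def rate (x y : M.State) : ℝ :=
  (∑ f, ∑ i, if x + M.e f i = y then M.externalRate f x i else 0) +
    ∑ f, ∑ i, ∑ j,
      if M.place f (x - M.e f i) j = y then
        (x f i : ℝ) * (M.session f).μ i.1 i.2 * M.routeAt f (x - M.e f i) i j
      else 0

open Classical in
/-- The generator of the continuous-time Markov chain on the state space. -/
noncomputable def generator (x y : M.State) : ℝ :=
  if x = y then -∑ z ∈ M.S.erase x, M.rate x z else M.rate x y

/-- `π` is a stationary distribution of the chain (extended by zero outside the state space). -/
structure IsStationary (π : M.State → ℝ) : Prop where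
  nonneg : ∀ x, 0 ≤ π x
  zero_outside : ∀ x, x ∉ M.S → π x = 0
  sum_one : ∑ x ∈ M.S, π x = 1
  balance : ∀ y ∈ M.S, ∑ x ∈ M.S, π x * M.generator x y = 0

/-! Traffic. -/

/-- The traffic intensity `ρ_i^f = ν^f γ_i^f / μ_i^f` of a phase. -/
noncomputable def ρ (f : SessionFlow K T) (i : (M.session f).Phase) : ℝ :=
  M.ν f * (M.session f).reachProb i / (M.session f).μ i.1 i.2

/-- The product `∏ (ρ_i^f)^{x_i^f} / x_i^f!`. -/
noncomputable def weight (x : M.State) : ℝ :=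
  ∏ f, ∏ i, M.ρ f i ^ x f i / (x f i).factorial

open Classical in
/-- The normalized product-form distribution on the state space. -/
noncomputable def productForm (x : M.State) : ℝ :=
  if x ∈ M.S then (∑ y ∈ M.S, M.weight y)⁻¹ * M.weight x else 0

open Classical in
/-- The arrival rates `λ_i^f(x)`: equal to `ν^f γ_i^f`, whatever the state `x`, as long as phase
`i` can admit a session. -/
noncomputable def arrivalRate (f : SessionFlow K T) (x : M.State) (i : (M.session f).Phase) : ℝ :=
  if x + M.e f i ∈ M.S then M.ν f * (M.session f).reachProb i else 0

/-- The rate, under `π`, of departures from phase `j` of flow `f` that leave the rest of the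
network in state `z`. -/
noncomputable def departureFlux (π : M.State → ℝ) (f : SessionFlow K T) (z : M.State)
    (j : (M.session f).Phase) : ℝ :=
  π (z + M.e f j) * ((z f j + 1 : ℕ) : ℝ) * (M.session f).μ j.1 j.2

/-- The rate, under `π`, of arrivals into phase `i` of flow `f`, external and internal, that find
the rest of the network in state `z`. -/
noncomputable def arrivalFlux (π : M.State → ℝ) (f : SessionFlow K T) (z : M.State)
    (i : (M.session f).Phase) : ℝ :=
  π z * M.externalRate f z i + ∑ j, M.departureFlux π f z j * M.routeAt f z j (some i)

/-! Blocking. -/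

/-- The rate, under `π`, at which sessions of flow `f` enter period `m`. -/
noncomputable def admittedRate (π : M.State → ℝ) (f : SessionFlow K T) (m : (M.session f).Period) : ℝ :=
  ∑ z ∈ M.S, M.arrivalFlux π f z ((M.session f).start m)

open Classical in
/-- The rate, under `π`, at which sessions of flow `f` are made to jump over the active period `m`:
either a requested session is refused a resource at its beginning, or a session is refused one
after an idle period, and `m` belongs to the run of active periods for which it was refused. -/
noncomputable def blockedRate (π : M.State → ℝ) (f : SessionFlow K T) (m : (M.session f).Period) : ℝ :=
  ∑ z ∈ M.S,
    ((if M.HasQubits f z ∧ z + M.e f ((M.session f).start 0) ∉ M.S ∧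
          (M.session f).ActiveRun 0 m then π z * M.ν f else 0) +
      ∑ j : (M.session f).Phase,
        if ∃ n, (M.session f).nextPeriod j.1 = some n ∧ M.Refused f z j.1 n ∧
            (M.session f).ActiveRun n m then
          M.departureFlux π f z j * (1 - (M.session f).cont j.1 j.2)
        else 0)

/-- The blocking probability of the active period `m` of a session of flow `f`: the long-run
fraction of its occurrences that are jumped over. -/
noncomputable def blockingProb (π : M.State → ℝ) (f : SessionFlow K T) (m : (M.session f).Period) : ℝ :=
  M.blockedRate π f m / (M.blockedRate π f m + M.admittedRate π f m)

open Classical in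
/-- The conditional probability under `π` that all `C` resources are engaged, given that the nodes
of flow `f` have unoccupied qubits. -/
noncomputable def probAllEngaged (π : M.State → ℝ) (f : SessionFlow K T) : ℝ :=
  (∑ x ∈ M.S.filter (fun x => M.HasQubits f x), π x)⁻¹ *
    ∑ x ∈ M.S.filter (fun x => M.HasQubits f x ∧ M.engaged x = M.C), π x

/-- The traffic intensity of a flow, split by the kind of period. -/
noncomputable def intensity (j : SessionFlow K T × PeriodKind) : ℝ :=
  ∑ i : (M.session j.1).Phase, if (M.session j.1).kind i.1 = j.2 then M.ρ j.1 i else 0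

/-- Numbers of sessions of each flow that are in an active, respectively idle, period, for which
the nodes of flow `f` have an unoccupied qubit and no resource or qubit limit is violated. -/
def occupancySet (f : SessionFlow K T) : Set (SessionFlow K T × PeriodKind → ℕ) :=
  {q | ∑ g, q (g, .active) ≤ M.C ∧
    ∀ k, (∑ g : SessionFlow K T, if g.Uses k then q (g, .active) + q (g, .idle) else 0) ≤ M.c k ∧
      (f.Uses k →
        (∑ g : SessionFlow K T, if g.Uses k then q (g, .active) + q (g, .idle) else 0) < M.c k)}

theorem occupancySet_finite (f : SessionFlow K T) : (M.occupancySet f).Finite := by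
  refine (Set.finite_Iic (fun j => M.c j.1.1.1.1 : SessionFlow K T × PeriodKind → ℕ)).subset ?_
  rintro q hq ⟨g, a⟩
  have h := (hq.2 g.1.1.1).1
  refine le_trans ?_ h
  calc q (g, a) ≤ q (g, .active) + q (g, .idle) := by cases a <;> omega
    _ = (if g.Uses g.1.1.1 then q (g, .active) + q (g, .idle) else 0) := by simp [SessionFlow.Uses]
    _ ≤ _ := Finset.single_le_sum
          (f := fun g' : SessionFlow K T =>
            if g'.Uses g.1.1.1 then q (g', .active) + q (g', .idle) else 0)
          (fun _ _ => Nat.zero_le _) (Finset.mem_univ g)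

noncomputable def occupancies (f : SessionFlow K T) : Finset (SessionFlow K T × PeriodKind → ℕ) :=
  (M.occupancySet_finite f).toFinset

/-- `∏_j ρ_j^{q_j} / q_j!`. -/
noncomputable def occupancyWeight (q : SessionFlow K T × PeriodKind → ℕ) : ℝ :=
  ∏ j, M.intensity j ^ q j / (q j).factorial

/-- The blocking formula for flow `f`: the normalized weight of the occupancies in which all `C`
resources are engaged, among those in which the nodes of `f` have unoccupied qubits. -/
noncomputable def blockingFormula (f : SessionFlow K T) : ℝ :=
  (∑ q ∈ M.occupancies f, M.occupancyWeight q)⁻¹ *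
    ∑ q ∈ (M.occupancies f).filter (fun q => ∑ g, q (g, .active) = M.C), M.occupancyWeight q

end EGS

/-! The product form works because blocking leaves the arrival rates of the admissible phases
unchanged. Without blocking a session skips no period, so it enters each one with probability one
(`reachProb_start`). Fix the state of the other sessions, with free qubits at the nodes of the flow.
If a resource is free, routing is the unblocked one and each period is entered at rate `ν`. If all
resources are engaged, active periods receive nothing, and jump-over links each idle period to the
preceding idle period, or to the beginning of the session if there is none, so idle periods are
still entered at rate `ν`. Hence `ν γ_i`, cut off where admission is impossible, solves the traffic
equations (`traffic_equations`).

Under the product form, departures from a phase that leave the others in `z` occur at rate `π z`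
times this arrival rate (`departureFlux_productForm`). Global balance then splits into two partial
balances: arrivals into a phase against its departures, and sessions leaving the network against
those entering it (`productForm_global_balance`). Uniqueness requires no irreducibility: the empty
state is reachable from everywhere because present sessions can all end, and this suffices for a
finite generator (`invariant_eq_zero`).

For an active period, entries have rate `ν P(free qubits, free resource)`. Jumps have rate `ν P(free
qubits, no resource)`, since exactly one event, the beginning of the session or the end of the last
earlier idle period, decides on it (`sum_last_idle`). The quotient is the conditional probability,
and the multinomial theorem lumps phases into active and idle occupancies (`sum_weight_eq`). -/

namespace SessionStructure

variable (s : SessionStructure)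

/-! ### Successors and the order of phases -/

theorem nextPhase_eq_some {i j : s.Phase} :
    s.nextPhase i = some j ↔ i.1 = j.1 ∧ (j.2 : ℕ) = i.2 + 1 := by
  obtain ⟨m, a⟩ := i
  obtain ⟨n, b⟩ := j
  unfold nextPhase
  constructor
  · intro h
    split_ifs at h with h'
    obtain ⟨rfl, h⟩ := Sigma.mk.inj (Option.some.inj h)
    exact ⟨rfl, by rw [← eq_of_heq h]⟩
  · rintro ⟨h, h'⟩
    dsimp only at h h'
    subst h
    rw [dif_pos (by dsimp only; omega)]
    congr 2
    exact Fin.ext h'.symm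

theorem nextPeriod_eq_some {m n : s.Period} : s.nextPeriod m = some n ↔ (n : ℕ) = m + 1 := by
  unfold nextPeriod
  split_ifs with h
  · simp [Fin.ext_iff, eq_comm]
  · simp; omega

theorem nextPeriod_eq_none {m : s.Period} : s.nextPeriod m = none ↔ m = Fin.last _ := by
  unfold nextPeriod
  split_ifs with h
  · simp [Fin.ext_iff]; omega
  · simp [Fin.ext_iff]; omega

theorem nextIdle_eq_some {m n : s.Period} :
    s.nextIdle m = some n ↔
      m < n ∧ s.kind n = .idle ∧ ∀ l, m < l → l < n → s.kind l = .active := by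
  unfold nextIdle
  split_ifs with h
  · have hm := Finset.min'_mem _ h
    simp only [Finset.mem_filter, Finset.mem_univ, true_and] at hm
    rw [Option.some_inj]
    constructor
    · intro e
      rw [e] at hm
      refine ⟨hm.1, hm.2, fun l h1 h2 => ?_⟩
      by_contra hl
      have hl' : s.kind l = .idle := by cases hk : s.kind l <;> simp_all
      have := Finset.min'_le (Finset.univ.filter fun n : s.Period => m < n ∧ s.kind n = .idle) l
        (by simp [h1, hl'])
      rw [e] at this
      exact absurd h2 (not_lt.2 this)
    · rintro ⟨h1, h2, h3⟩
      refine le_antisymm (Finset.min'_le _ _ (by simp [h1, h2])) ?_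
      by_contra hlt
      have := h3 _ hm.1 (not_le.1 hlt)
      rw [hm.2] at this
      cases this
  · simp only [false_iff, not_and]
    intro h1 h2
    exact absurd ⟨n, by simp [h1, h2]⟩ h

theorem kind_eq_idle {m : s.Period} : s.kind m = .idle ↔ s.kind m ≠ .active := by
  cases s.kind m <;> simp

/-- Phase `j` comes after phase `i` in the course of a session. -/
def Later (i j : s.Phase) : Prop := i.1 < j.1 ∨ i.1 = j.1 ∧ (i.2 : ℕ) < j.2

theorem Later.irrefl (i : s.Phase) : ¬ s.Later i i := by simp [Later]

theorem Later.trans {i j k : s.Phase} (h : s.Later i j) (h' : s.Later j k) : s.Later i k := by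
  unfold Later at *
  rcases h with h | ⟨h, h2⟩ <;> rcases h' with h' | ⟨h', h2'⟩
  · exact Or.inl (h.trans h')
  · exact Or.inl (h' ▸ h)
  · exact Or.inl (h ▸ h')
  · exact Or.inr ⟨h.trans h', h2.trans h2'⟩

open Classical in
/-- The number of phases that come after phase `i`. -/
noncomputable def rank (i : s.Phase) : ℕ := (Finset.univ.filter fun j => s.Later i j).card

theorem rank_lt {i j : s.Phase} (h : s.Later i j) : s.rank j < s.rank i := by
  classical
  unfold rank
  refine Finset.card_lt_card (Finset.ssubset_iff_of_subset ?_ |>.2 ⟨j, ?_, ?_⟩)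
  · intro k hk
    simp only [Finset.mem_filter, Finset.mem_univ, true_and] at hk ⊢
    exact Later.trans s h hk
  · simpa using h
  · simpa using Later.irrefl s j

theorem later_of_nextPhase {i j : s.Phase} (h : s.nextPhase i = some j) : s.Later i j := by
  rw [nextPhase_eq_some] at h
  exact Or.inr ⟨h.1, by omega⟩

theorem later_start {i : s.Phase} {n : s.Period} (h : i.1 < n) : s.Later i (s.start n) :=
  Or.inl h

theorem lt_of_nextPeriod {m n : s.Period} (h : s.nextPeriod m = some n) : m < n := by
  rw [nextPeriod_eq_some] at h
  exact Fin.lt_def.2 (by omega)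

/-! ### Visit probabilities without blocking -/

/-- The continuation probability at the `l`-th phase of period `m`, zero if there is none. -/
noncomputable def contAt (m : s.Period) (l : ℕ) : ℝ :=
  if h : l < s.lastPhase m + 1 then s.cont m ⟨l, h⟩ else 0

theorem contAt_val (m : s.Period) (l : Fin (s.lastPhase m + 1)) : s.contAt m l = s.cont m l := by
  rw [contAt, dif_pos l.2]

/-- The probability to get from phase `a` to phase `b` within period `m`, for `a ≤ b`. -/
noncomputable def survival (m : s.Period) (a b : ℕ) : ℝ := ∏ l ∈ Finset.Ico a b, s.contAt m l

/-- The probability that a session now in phase `j` visits phase `i`. -/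
noncomputable def hitProb (i j : s.Phase) : ℝ :=
  if j.1 < i.1 then s.survival i.1 0 i.2
  else if j.1 = i.1 ∧ (j.2 : ℕ) ≤ i.2 then s.survival i.1 j.2 i.2 else 0

theorem cont_eq_zero {i : s.Phase} (h : s.nextPhase i = none) : s.cont i.1 i.2 = 0 := by
  unfold nextPhase at h
  split_ifs at h with h'
  have : i.2 = Fin.last _ := Fin.ext (by have := i.2.2; simp; omega)
  rw [this, s.cont_last]

theorem sum_ite_option {α : Type*} [Fintype α] [DecidableEq α] (o : Option α) (c : ℝ) (g : α → ℝ) :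
    ∑ k, (if o = some k then c else 0) * g k = o.elim 0 fun k => c * g k := by
  cases o with
  | none => simp
  | some a => simp

theorem sum_route_mul (j : s.Phase) (g : s.Phase → ℝ) :
    ∑ k, s.route j (some k) * g k =
      ((s.nextPhase j).elim 0 fun k => s.cont j.1 j.2 * g k) +
        (s.nextPeriod j.1).elim 0 fun n => (1 - s.cont j.1 j.2) * g (s.start n) := by
  simp only [route, add_mul, Finset.sum_add_distrib]
  rw [sum_ite_option, sum_ite_option]
  cases s.nextPeriod j.1 <;> rfl

theorem hitProb_self (i : s.Phase) : s.hitProb i i = 1 := by simp [hitProb, survival]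

theorem hitProb_of_fst_gt {i j : s.Phase} (h : i.1 < j.1) : s.hitProb i j = 0 := by
  rw [hitProb, if_neg (not_lt.2 h.le), if_neg (fun h' => h.ne' h'.1)]

theorem hitProb_start {i : s.Phase} {n : s.Period} (h : n ≤ i.1) :
    s.hitProb i (s.start n) = s.survival i.1 0 i.2 := by
  rcases h.lt_or_eq with h | h
  · simp [hitProb, start, h]
  · simp [hitProb, start, h]

/-- First-step analysis. From an earlier period, continuing or completing makes no difference, as
the period of `i` is entered with certainty. Within the period of `i`, only the next phase of that
period matters, since completing it forfeits `i`. From a later period all terms vanish. -/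
theorem hitProb_step {i j : s.Phase} (hij : j ≠ i) :
    s.hitProb i j = ∑ k, s.route j (some k) * s.hitProb i k := by
  rw [sum_route_mul]
  rcases lt_trichotomy j.1 i.1 with h | h | h
  · obtain ⟨n, hn⟩ : ∃ n, s.nextPeriod j.1 = some n := by
      refine Option.ne_none_iff_exists'.1 fun h' => ?_
      rw [nextPeriod_eq_none] at h'
      exact absurd (h' ▸ h) (not_lt.2 (Fin.le_last _))
    have hn' : n ≤ i.1 := by
      rw [nextPeriod_eq_some] at hn
      rw [Fin.le_def, hn]
      exact h
    have e : s.hitProb i j = s.survival i.1 0 i.2 := by rw [hitProb, if_pos h]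
    rw [hn, Option.elim_some, s.hitProb_start hn', e]
    cases hp : s.nextPhase j with
    | none => simp [s.cont_eq_zero hp]
    | some k =>
      have hk := (s.nextPhase_eq_some).1 hp
      have : s.hitProb i k = s.survival i.1 0 i.2 := by rw [hitProb, if_pos (hk.1 ▸ h)]
      rw [Option.elim_some, this]
      ring
  · have e2 : ((s.nextPeriod j.1).elim 0 fun n =>
        (1 - s.cont j.1 j.2) * s.hitProb i (s.start n)) = 0 := by
      cases hp : s.nextPeriod j.1 with
      | none => rfl
      | some n =>
        have := s.lt_of_nextPeriod hp
        rw [Option.elim_some, s.hitProb_of_fst_gt (by rw [h] at this; exact this), mul_zero]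
    rw [e2, add_zero]
    obtain ⟨m, a⟩ := i
    obtain ⟨m', b⟩ := j
    dsimp only at h
    subst h
    have hab : (b : ℕ) ≠ a := fun h => hij (by rw [Fin.ext h])
    cases hp : s.nextPhase ⟨m', b⟩ with
    | none =>
      have hb : ¬ (b : ℕ) ≤ a := by
        intro hle
        unfold nextPhase at hp
        split_ifs at hp with h'
        have := a.2
        dsimp only at h'
        omega
      simp [hitProb, hb]
    | some k =>
      obtain ⟨hk1, hk2⟩ := (s.nextPhase_eq_some).1 hp
      obtain ⟨m, l⟩ := k
      dsimp only at hk1 hk2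
      subst hk1
      rw [Option.elim_some]
      by_cases hb : (b : ℕ) ≤ a
      · simp only [hitProb, lt_irrefl, if_false, true_and, hb, if_true, hk2,
          show (b : ℕ) + 1 ≤ a by omega]
        rw [survival, survival, Finset.prod_eq_prod_Ico_succ_bot (by omega), contAt_val]
      · simp [hitProb, hb, hk2, show ¬ (b : ℕ) + 1 ≤ a by omega]
  · rw [s.hitProb_of_fst_gt h]
    have e2 : ((s.nextPeriod j.1).elim 0 fun n =>
        (1 - s.cont j.1 j.2) * s.hitProb i (s.start n)) = 0 := by
      cases hp : s.nextPeriod j.1 with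
      | none => rfl
      | some n =>
        have := s.lt_of_nextPeriod hp
        rw [Option.elim_some, s.hitProb_of_fst_gt (h.trans this), mul_zero]
    rw [e2, add_zero]
    cases hp : s.nextPhase j with
    | none => rfl
    | some k =>
      have hk := (s.nextPhase_eq_some).1 hp
      rw [Option.elim_some, s.hitProb_of_fst_gt (hk.1 ▸ h), mul_zero]

theorem later_of_route_ne_zero {j k : s.Phase} (h : s.route j (some k) ≠ 0) : s.Later j k := by
  by_contra hl
  apply h
  unfold route
  rw [if_neg (fun h' => hl (s.later_of_nextPhase h')), if_neg, add_zero]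
  intro h'
  obtain ⟨n, hn, rfl⟩ := Option.map_eq_some_iff.1 h'
  exact hl (s.later_start (s.lt_of_nextPeriod hn))

/-- Each transition strictly lowers `rank`, so `rank j` steps exhaust the future of a session in
`j`; at rank zero no further phase is reachable. -/
theorem hitWithin_eq (i : s.Phase) :
    ∀ (n : ℕ) (j : s.Phase), s.rank j ≤ n → s.hitWithin i n j = s.hitProb i j
  | 0, j, h => by
    rw [hitWithin]
    split_ifs with hij
    · rw [hij, hitProb_self]
    · rw [s.hitProb_step hij]
      refine (Finset.sum_eq_zero fun k _ => ?_).symm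
      by_cases hk : s.route j (some k) = 0
      · rw [hk, zero_mul]
      · have := s.rank_lt (s.later_of_route_ne_zero hk)
        omega
  | n + 1, j, h => by
    rw [hitWithin]
    split_ifs with hij
    · rw [hij, hitProb_self]
    · rw [s.hitProb_step hij]
      refine Finset.sum_congr rfl fun k _ => ?_
      by_cases hk : s.route j (some k) = 0
      · rw [hk, zero_mul, zero_mul]
      · have := s.rank_lt (s.later_of_route_ne_zero hk)
        rw [hitWithin_eq i n k (by omega)]

theorem reachProb_eq (i : s.Phase) : s.reachProb i = s.survival i.1 0 i.2 := by
  rw [reachProb, hitWithin_eq _ _ _ _ (Finset.card_le_univ _), s.hitProb_start (Fin.zero_le _)]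

/-- This makes jumping harmless: all periods carry the same flow `ν`, so a jump from one idle period
to the next conserves it. -/
theorem reachProb_start (m : s.Period) : s.reachProb (s.start m) = 1 := by
  simp [reachProb_eq, start, survival]

theorem reachProb_nonneg (i : s.Phase) : 0 ≤ s.reachProb i := by
  rw [reachProb_eq]
  refine Finset.prod_nonneg fun l _ => ?_
  unfold contAt
  split_ifs
  · exact s.cont_nonneg _ _
  · exact le_rfl

theorem reachProb_nextPhase {i j : s.Phase} (h : s.nextPhase i = some j) :
    s.reachProb j = s.reachProb i * s.cont i.1 i.2 := by
  obtain ⟨h1, h2⟩ := s.nextPhase_eq_some.1 h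
  obtain ⟨m, a⟩ := i
  obtain ⟨n, b⟩ := j
  dsimp only at h1 h2
  subst h1
  rw [reachProb_eq, reachProb_eq]
  simp only [survival, h2]
  rw [Finset.prod_Ico_succ_top (by omega), contAt_val]

/-! ### Completion of periods and the last idle period -/

/-- A session that enters period `m` completes it. -/
theorem sum_reachProb_completion (m : s.Period) :
    ∑ l, s.reachProb ⟨m, l⟩ * (1 - s.cont m l) = 1 := by
  -- The probability of completing the period at phase `l` is a drop of `survival`; the drops
  -- telescope from 1 to 0, as `cont` vanishes at the last phase.
  have h : ∀ l : Fin (s.lastPhase m + 1), s.reachProb ⟨m, l⟩ * (1 - s.cont m l) =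
      s.survival m 0 (l : ℕ) - s.survival m 0 ((l : ℕ) + 1) := by
    intro l
    rw [reachProb_eq]
    unfold survival
    rw [Finset.prod_Ico_succ_top (by omega), contAt_val]
    ring
  simp only [h]
  rw [Fin.sum_univ_eq_sum_range (fun l => s.survival m 0 l - s.survival m 0 (l + 1)),
    Finset.sum_range_sub', survival, survival, Finset.prod_Ico_succ_top (by omega),
    show s.contAt m (s.lastPhase m) = 0 from (s.contAt_val m (Fin.last _)).trans (s.cont_last m)]
  simp

/-- The sum over all phases of the rate at which a period is completed there. -/
theorem sum_reachProb_mul (g : s.Period → ℝ) :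
    ∑ j : s.Phase, s.reachProb j * g j.1 * (1 - s.cont j.1 j.2) = ∑ m, g m := by
  rw [Fintype.sum_sigma]
  refine Finset.sum_congr rfl fun m _ => ?_
  rw [← mul_one (g m), ← s.sum_reachProb_completion m, Finset.mul_sum]
  refine Finset.sum_congr rfl fun l _ => ?_
  simp only
  rw [s.sum_reachProb_completion m]
  ring

/-- The last idle period before `m`, or the fact that there is none. -/
theorem exists_last_idle (m : s.Period) :
    (∀ l < m, s.kind l = .active) ∨
      ∃ l < m, s.kind l = .idle ∧ ∀ l', l < l' → l' < m → s.kind l' = .active := by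
  by_cases h : (Finset.univ.filter fun l : s.Period => l < m ∧ s.kind l = .idle).Nonempty
  · right
    have hm := Finset.max'_mem _ h
    simp only [Finset.mem_filter, Finset.mem_univ, true_and] at hm
    refine ⟨_, hm.1, hm.2, fun l' h1 h2 => ?_⟩
    by_contra h3
    exact absurd h1 (not_lt.2 (Finset.le_max' _ _ (by simp [h2, s.kind_eq_idle, h3])))
  · left
    intro l hl
    by_contra h3
    exact h ⟨l, by simp [hl, s.kind_eq_idle, h3]⟩

/-- Each period is preceded by exactly one idle period or the beginning of the session, with only
active periods in between. -/
theorem sum_last_idle (m : s.Period) (p : Prop) [Decidable p] (P : s.Period → Prop)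
    [DecidablePred P] (hp : p ↔ ∀ l < m, s.kind l = .active)
    (hP : ∀ l, P l ↔ l < m ∧ s.kind l = .idle ∧ ∀ l', l < l' → l' < m → s.kind l' = .active) :
    (if p then (1 : ℝ) else 0) + ∑ l, (if P l then (1 : ℝ) else 0) = 1 := by
  rcases s.exists_last_idle m with h | ⟨l, h1, h2, h3⟩
  · rw [if_pos (hp.2 h), Finset.sum_eq_zero, add_zero]
    intro l _
    rw [if_neg]
    rw [hP]
    rintro ⟨h1, h2, -⟩
    rw [h l h1] at h2
    cases h2
  · rw [if_neg, Finset.sum_eq_single l, if_pos ((hP l).2 ⟨h1, h2, h3⟩), zero_add]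
    · intro l' _ hne
      rw [if_neg]
      rw [hP]
      rintro ⟨h1', h2', h3'⟩
      rcases lt_or_gt_of_ne hne with h | h
      · rw [h3' l h h1] at h2
        cases h2
      · rw [h3 l' h h1'] at h2'
        cases h2'
    · simp
    · rw [hp]
      intro h
      rw [h l h1] at h2
      cases h2

end SessionStructure

namespace EGS

variable {K T : ℕ} (M : EGS K T)

/-! ### Unit vectors and admission to the state space -/

theorem e_apply_self (f : SessionFlow K T) (i : (M.session f).Phase) : M.e f i f i = 1 := by
  simp [e]

theorem e_apply_ne {f g : SessionFlow K T} {i : (M.session f).Phase} {j : (M.session g).Phase}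
    (h : (⟨g, j⟩ : (f : SessionFlow K T) × (M.session f).Phase) ≠ ⟨f, i⟩) : M.e f i g j = 0 := by
  unfold e
  by_cases hg : g = f
  · subst hg
    have : j ≠ i := fun h' => h (by rw [h'])
    simp [this]
  · simp [hg]

/-- `engaged`, `qubits` and `remaining` are linear in the state; this evaluates each of them on a
unit vector. -/
theorem sum_e {A : Type*} [AddCommMonoid A] [Module ℕ A] (f : SessionFlow K T)
    (i : (M.session f).Phase) (w : (g : SessionFlow K T) → (M.session g).Phase → A) :
    ∑ g, ∑ j, M.e f i g j • w g j = w f i := by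
  rw [← Fintype.sum_sigma' (fun g j => M.e f i g j • w g j), Finset.sum_eq_single ⟨f, i⟩]
  · simp [e_apply_self]
  · rintro ⟨g, j⟩ - h
    simp [M.e_apply_ne h]
  · simp

theorem engaged_add (x y : M.State) : M.engaged (x + y) = M.engaged x + M.engaged y := by
  unfold engaged
  simp only [← Finset.sum_add_distrib]
  refine Finset.sum_congr rfl fun f _ => Finset.sum_congr rfl fun i _ => ?_
  split_ifs <;> simp

theorem engaged_e (f : SessionFlow K T) (i : (M.session f).Phase) :
    M.engaged (M.e f i) = if (M.session f).kind i.1 = .active then 1 else 0 := by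
  rw [← M.sum_e f i (fun g j => if (M.session g).kind j.1 = .active then 1 else 0)]
  simp [engaged]

theorem qubits_add (x y : M.State) (k : Fin K) :
    M.qubits (x + y) k = M.qubits x k + M.qubits y k := by
  unfold qubits
  simp only [← Finset.sum_add_distrib]
  refine Finset.sum_congr rfl fun f _ => ?_
  split_ifs <;> simp [Finset.sum_add_distrib]

theorem qubits_e (f : SessionFlow K T) (i : (M.session f).Phase) (k : Fin K) :
    M.qubits (M.e f i) k = if f.Uses k then 1 else 0 := by
  rw [← M.sum_e f i (fun g _ => if g.Uses k then 1 else 0), qubits]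
  refine Finset.sum_congr rfl fun g _ => ?_
  split_ifs <;> simp

theorem mem_S_of_add {z : M.State} {f : SessionFlow K T} {i : (M.session f).Phase}
    (h : z + M.e f i ∈ M.S) : z ∈ M.S := by
  rw [mem_S] at h ⊢
  refine ⟨le_trans ?_ h.1, fun k => le_trans ?_ (h.2 k)⟩
  · rw [engaged_add]; omega
  · rw [qubits_add]; omega

/-- Admission depends on the phase only through the kind of its period, so the cutoff in
`arrivalRate` is constant on each period. -/
theorem add_mem_S {z : M.State} (hz : z ∈ M.S) (f : SessionFlow K T) (i : (M.session f).Phase) :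
    z + M.e f i ∈ M.S ↔
      M.HasQubits f z ∧ ((M.session f).kind i.1 = .active → M.engaged z < M.C) := by
  rw [mem_S] at hz
  simp only [mem_S, engaged_add, engaged_e, qubits_add, qubits_e, HasQubits]
  constructor
  · rintro ⟨h1, h2⟩
    refine ⟨fun k hk => ?_, fun ha => ?_⟩
    · have := h2 k
      rw [if_pos hk] at this
      omega
    · rw [if_pos ha] at h1
      omega
  · rintro ⟨h1, h2⟩
    refine ⟨?_, fun k => ?_⟩
    · split_ifs with ha
      · have := h2 ha
        omega
      · exact hz.1
    · split_ifs with hk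
      · have := h1 k hk
        omega
      · exact hz.2 k

theorem zero_mem_S : (0 : M.State) ∈ M.S := by
  simp [mem_S, engaged, qubits]

theorem sub_add_e {x : M.State} {f : SessionFlow K T} {i : (M.session f).Phase} (h : x f i ≠ 0) :
    x - M.e f i + M.e f i = x := by
  funext g j
  simp only [Pi.add_apply, Pi.sub_apply]
  by_cases hp : (⟨g, j⟩ : (f : SessionFlow K T) × (M.session f).Phase) = ⟨f, i⟩
  · obtain ⟨rfl, hp⟩ := Sigma.mk.inj hp
    rw [eq_of_heq hp, e_apply_self]
    omega
  · rw [M.e_apply_ne hp]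
    rfl

theorem add_sub_e (z : M.State) (f : SessionFlow K T) (i : (M.session f).Phase) :
    z + M.e f i - M.e f i = z := by
  funext g j
  simp only [Pi.add_apply, Pi.sub_apply]
  omega

theorem sub_e_mem_S {x : M.State} (hx : x ∈ M.S) {f : SessionFlow K T}
    {i : (M.session f).Phase} (h : x f i ≠ 0) : x - M.e f i ∈ M.S :=
  M.mem_S_of_add (f := f) (i := i) (by rwa [M.sub_add_e h])

/-! Weights. -/

theorem ρ_nonneg (f : SessionFlow K T) (i : (M.session f).Phase) : 0 ≤ M.ρ f i :=
  div_nonneg (mul_nonneg (M.ν_nonneg f) ((M.session f).reachProb_nonneg i))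
    ((M.session f).μ_pos _ _).le

theorem ρ_mul_μ (f : SessionFlow K T) (i : (M.session f).Phase) :
    M.ρ f i * (M.session f).μ i.1 i.2 = M.ν f * (M.session f).reachProb i :=
  div_mul_cancel₀ _ ((M.session f).μ_pos _ _).ne'

theorem weight_nonneg (x : M.State) : 0 ≤ M.weight x :=
  Finset.prod_nonneg fun _ _ => Finset.prod_nonneg fun _ _ =>
    div_nonneg (pow_nonneg (M.ρ_nonneg _ _) _) (Nat.cast_nonneg _)

theorem weight_zero : M.weight 0 = 1 := by simp [weight]

theorem sum_weight_pos : 0 < ∑ y ∈ M.S, M.weight y :=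
  Finset.sum_pos' (fun y _ => M.weight_nonneg y) ⟨0, M.zero_mem_S, by simp [weight_zero]⟩

/-- The ratio of consecutive Poisson weights, multiplied out because weights vanish where some `ρ`
is zero. -/
theorem weight_add_e (z : M.State) (f : SessionFlow K T) (i : (M.session f).Phase) :
    M.weight (z + M.e f i) * ((z f i + 1 : ℕ) : ℝ) = M.weight z * M.ρ f i := by
  classical
  unfold weight
  rw [← Fintype.prod_sigma' (fun g j => M.ρ g j ^ (z + M.e f i) g j / ((z + M.e f i) g j).factorial),
    ← Fintype.prod_sigma' (fun g j => M.ρ g j ^ z g j / (z g j).factorial),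
    ← Finset.mul_prod_erase _ _ (Finset.mem_univ ⟨f, i⟩),
    ← Finset.mul_prod_erase Finset.univ (fun p : (g : SessionFlow K T) × (M.session g).Phase =>
      M.ρ p.1 p.2 ^ z p.1 p.2 / (z p.1 p.2).factorial) (Finset.mem_univ ⟨f, i⟩)]
  have : ∀ p ∈ Finset.univ.erase (⟨f, i⟩ : (g : SessionFlow K T) × (M.session g).Phase),
      M.ρ p.1 p.2 ^ (z + M.e f i) p.1 p.2 / ((z + M.e f i) p.1 p.2).factorial =
        M.ρ p.1 p.2 ^ z p.1 p.2 / (z p.1 p.2).factorial := by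
    rintro ⟨g, j⟩ hp
    have h0 := M.e_apply_ne (Finset.ne_of_mem_erase hp)
    simp only [Pi.add_apply, h0, add_zero]
  rw [Finset.prod_congr rfl this]
  have h1 : (z + M.e f i) f i = z f i + 1 := by
    simp only [Pi.add_apply, e_apply_self]
  simp only [h1]
  have h2 : ((z f i).factorial : ℝ) ≠ 0 := by positivity
  rw [Nat.factorial_succ, pow_succ]
  push_cast
  field_simp

theorem productForm_of_mem {x : M.State} (h : x ∈ M.S) :
    M.productForm x = (∑ y ∈ M.S, M.weight y)⁻¹ * M.weight x := if_pos h

theorem productForm_of_not_mem {x : M.State} (h : x ∉ M.S) : M.productForm x = 0 := if_neg h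

theorem productForm_nonneg (x : M.State) : 0 ≤ M.productForm x := by
  by_cases h : x ∈ M.S
  · rw [M.productForm_of_mem h]
    exact mul_nonneg (inv_nonneg.2 M.sum_weight_pos.le) (M.weight_nonneg x)
  · rw [M.productForm_of_not_mem h]

theorem productForm_zero_pos : 0 < M.productForm 0 := by
  rw [M.productForm_of_mem M.zero_mem_S, weight_zero, mul_one]
  exact inv_pos.2 M.sum_weight_pos

theorem sum_productForm : ∑ x ∈ M.S, M.productForm x = 1 := by
  rw [Finset.sum_congr rfl fun x hx => M.productForm_of_mem hx, ← Finset.mul_sum,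
    inv_mul_cancel₀ M.sum_weight_pos.ne']

/-- Under the product form, phases behave like queues with the arrival rates `arrivalRate`. -/
theorem departureFlux_productForm {z : M.State} (hz : z ∈ M.S) (f : SessionFlow K T)
    (j : (M.session f).Phase) :
    M.departureFlux M.productForm f z j = M.productForm z * M.arrivalRate f z j := by
  unfold departureFlux arrivalRate
  split_ifs with h
  · rw [M.productForm_of_mem h, M.productForm_of_mem hz, ← M.ρ_mul_μ f j,
      mul_assoc _ (M.weight _) _, M.weight_add_e]
    ring
  · rw [M.productForm_of_not_mem h]
    ring

/-! Traffic equations. -/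

theorem arrivalRate_eq {x : M.State} (f : SessionFlow K T) (i : (M.session f).Phase)
    {p : (M.session f).Period → Prop} [DecidablePred p] (hp : x + M.e f i ∈ M.S ↔ p i.1) :
    M.arrivalRate f x i = M.ν f * ((M.session f).reachProb i * if p i.1 then 1 else 0) := by
  unfold arrivalRate
  rw [if_congr hp rfl rfl]
  split_ifs <;> simp

theorem map_start_eq_some {s : SessionStructure} {o : Option s.Period} {m : s.Period} :
    o.map s.start = some (s.start m) ↔ o = some m := by
  rw [Option.map_eq_some_iff]
  constructor
  · rintro ⟨n, rfl, h⟩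
    rw [(Sigma.mk.inj h).1]
  · rintro rfl
    exact ⟨m, rfl, rfl⟩

theorem afterPeriod_of_engaged_lt {z : M.State} (hz : z ∈ M.S) {f : SessionFlow K T}
    (hq : M.HasQubits f z) (hC : M.engaged z < M.C) (m : (M.session f).Period) :
    M.afterPeriod f z m = ((M.session f).nextPeriod m).map (M.session f).start := by
  unfold afterPeriod
  cases hn : (M.session f).nextPeriod m with
  | none => rfl
  | some n =>
    have : ¬ M.Refused f z m n := by
      rintro ⟨-, -, h⟩
      exact h ((M.add_mem_S hz f _).2 ⟨hq, fun _ => hC⟩)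
    simp [this]

/-- An idle successor is itself the next idle period, while an active one is refused and jumped
over; both cases have the same destination. -/
theorem afterPeriod_of_engaged_eq {z : M.State} (hz : z ∈ M.S) {f : SessionFlow K T}
    (hC : M.engaged z = M.C) {m : (M.session f).Period} (hm : (M.session f).kind m = .idle) :
    M.afterPeriod f z m = ((M.session f).nextIdle m).map (M.session f).start := by
  unfold afterPeriod
  cases hn : (M.session f).nextPeriod m with
  | none =>
    rw [(M.session f).nextPeriod_eq_none] at hn
    rw [hn, (M.session f).kind_last] at hm
    cases hm
  | some n =>
    have hn' := (M.session f).nextPeriod_eq_some.1 hn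
    by_cases hk : (M.session f).kind n = .active
    · have hr : M.Refused f z m n := by
        refine ⟨hm, hk, fun h => ?_⟩
        have := ((M.add_mem_S hz f _).1 h).2 hk
        omega
      dsimp only
      rw [if_pos hr]
      -- The search for an idle period may start after `m` instead of `n`, since `n` is active.
      congr 1
      ext l
      rw [(M.session f).nextIdle_eq_some, (M.session f).nextIdle_eq_some]
      constructor
      · rintro ⟨h1, h2, h3⟩
        refine ⟨Fin.lt_def.2 (by rw [Fin.lt_def] at h1; omega), h2, fun l' h4 h5 => ?_⟩
        by_cases h6 : l' = n
        · rw [h6, hk]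
        · exact h3 l' (Fin.lt_def.2 (by rw [Fin.lt_def] at h4; rw [Fin.ext_iff] at h6; omega)) h5
      · rintro ⟨h1, h2, h3⟩
        refine ⟨?_, h2, fun l' h4 h5 =>
          h3 l' (Fin.lt_def.2 (by rw [Fin.lt_def] at h4; omega)) h5⟩
        have : l ≠ n := by
          rintro rfl
          rw [hk] at h2
          cases h2
        exact Fin.lt_def.2 (by rw [Fin.lt_def] at h1; rw [Ne, Fin.ext_iff] at this; omega)
    · have hr : ¬ M.Refused f z m n := fun h => hk h.2.1
      have hi : (M.session f).nextIdle m = some n := by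
        refine (M.session f).nextIdle_eq_some.2 ⟨(M.session f).lt_of_nextPeriod hn, (M.session f).kind_eq_idle.2 hk, fun l h1 h2 => ?_⟩
        rw [Fin.lt_def] at h1 h2
        omega
      dsimp only
      rw [if_neg hr, hi, Option.map_some]

open Classical in
/-- Flows into phase `i` from all phases, for arrival rates of the form `ν γ 1_p`. -/
theorem sum_routeAt (f : SessionFlow K T) (x : M.State) (i : (M.session f).Phase)
    (p : (M.session f).Period → Prop) [DecidablePred p] :
    ∑ j : (M.session f).Phase, (M.ν f * ((M.session f).reachProb j * if p j.1 then 1 else 0)) *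
        M.routeAt f x j (some i) =
      M.ν f * ((∑ j, if (M.session f).nextPhase j = some i then
          (M.session f).reachProb i * (if p i.1 then 1 else 0) else 0) +
        ∑ m, if M.afterPeriod f x m = some i ∧ p m then 1 else 0) := by
  -- Distributes each completed period over the phases in which it can be completed, so that both
  -- sides are sums over `j`.
  rw [← (M.session f).sum_reachProb_mul, ← Finset.sum_add_distrib, Finset.mul_sum]
  refine Finset.sum_congr rfl fun j _ => ?_
  unfold routeAt
  by_cases h : (M.session f).nextPhase j = some i
  · rw [if_pos h, if_pos h, (M.session f).reachProb_nextPhase h,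
      ← ((M.session f).nextPhase_eq_some.1 h).1, ite_and]
    split_ifs <;> ring
  · rw [if_neg h, if_neg h, ite_and]
    split_ifs <;> ring

theorem sum_nextPhase {s : SessionStructure} (i : s.Phase) (c : ℝ) :
    (∑ j, if s.nextPhase j = some i then c else 0) = if (i.2 : ℕ) = 0 then 0 else c := by
  obtain ⟨m, b⟩ := i
  split_ifs with h
  · refine Finset.sum_eq_zero fun j _ => if_neg fun h' => ?_
    have := (s.nextPhase_eq_some.1 h').2
    omega
  · have hb := b.2
    dsimp only at h
    rw [Finset.sum_eq_single (⟨m, ⟨b - 1, by omega⟩⟩ : s.Phase)]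
    · rw [if_pos]
      rw [s.nextPhase_eq_some]
      exact ⟨rfl, by dsimp only; omega⟩
    · rintro ⟨m', b'⟩ - hne
      refine if_neg fun h' => hne ?_
      obtain ⟨h1, h2⟩ := s.nextPhase_eq_some.1 h'
      dsimp only at h1 h2
      subst h1
      congr 1
      exact Fin.ext (by dsimp only; omega)
    · simp

theorem snd_eq_zero_of_map_start {s : SessionStructure} {o : Option s.Period} {i : s.Phase}
    (h : o.map s.start = some i) : (i.2 : ℕ) = 0 := by
  obtain ⟨n, -, rfl⟩ := Option.map_eq_some_iff.1 h
  rfl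

theorem snd_eq_zero_of_afterPeriod {f : SessionFlow K T} {x : M.State}
    {m : (M.session f).Period} {i : (M.session f).Phase} (h : M.afterPeriod f x m = some i) :
    (i.2 : ℕ) = 0 := by
  unfold afterPeriod at h
  cases hn : (M.session f).nextPeriod m with
  | none => simp [hn] at h
  | some n =>
    rw [hn] at h
    dsimp only at h
    split_ifs at h
    · exact snd_eq_zero_of_map_start h
    · rw [← Option.some.inj h]
      rfl

theorem snd_eq_zero_of_entry {f : SessionFlow K T} {x : M.State}
    {i : (M.session f).Phase} (h : M.entry f x = some i) : (i.2 : ℕ) = 0 := by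
  unfold entry at h
  split_ifs at h
  · rw [← Option.some.inj h]
    rfl
  · exact snd_eq_zero_of_map_start h

/-- The unblocked counterpart of `sum_last_idle`: each period has one source, its predecessor or the
beginning of the session. -/
theorem sum_nextPeriod {s : SessionStructure} (m : s.Period) :
    (if m = 0 then (1 : ℝ) else 0) + ∑ l, (if s.nextPeriod l = some m then (1 : ℝ) else 0) = 1 := by
  have hm := m.2
  by_cases h : m = 0
  · rw [if_pos h, Finset.sum_eq_zero, add_zero]
    intro l _
    refine if_neg fun h' => ?_
    rw [s.nextPeriod_eq_some, h] at h'
    simp at h'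
  · have h0 : (m : ℕ) ≠ 0 := fun h' => h (Fin.ext h')
    rw [if_neg h, zero_add, Finset.sum_eq_single (⟨m - 1, by omega⟩ : s.Period), if_pos]
    · rw [s.nextPeriod_eq_some]
      dsimp only
      omega
    · intro l _ hne
      refine if_neg fun h' => hne (Fin.ext ?_)
      rw [s.nextPeriod_eq_some] at h'
      dsimp only
      omega
    · simp

theorem entry_of_engaged_lt {x : M.State} (hx : x ∈ M.S) {f : SessionFlow K T}
    (hq : M.HasQubits f x) (hC : M.engaged x < M.C) :
    M.entry f x = some ((M.session f).start 0) := by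
  rw [entry, if_pos hq, if_pos ((M.add_mem_S hx f _).2 ⟨hq, fun _ => hC⟩)]

theorem start_zero_not_mem {x : M.State} (hx : x ∈ M.S) (f : SessionFlow K T)
    (hC : M.engaged x = M.C) : x + M.e f ((M.session f).start 0) ∉ M.S := fun h => by
  have := ((M.add_mem_S hx f _).1 h).2 (M.session f).kind_first
  omega

theorem entry_of_engaged_eq {x : M.State} (hx : x ∈ M.S) {f : SessionFlow K T}
    (hq : M.HasQubits f x) (hC : M.engaged x = M.C) :
    M.entry f x = ((M.session f).nextIdle 0).map (M.session f).start := by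
  rw [entry, if_pos hq, if_neg (M.start_zero_not_mem hx f hC)]

open Classical in
/-- The state-independent arrival rates solve the traffic equations. -/
theorem traffic_equations {x : M.State} (hx : x ∈ M.S) (f : SessionFlow K T)
    (i : (M.session f).Phase) :
    M.arrivalRate f x i =
      M.externalRate f x i + ∑ j, M.arrivalRate f x j * M.routeAt f x j (some i) := by
  by_cases hq : M.HasQubits f x
  swap
  · have h : ∀ j, M.arrivalRate f x j = 0 := fun j =>
      if_neg fun h => hq ((M.add_mem_S hx f j).1 h).1
    simp [h, externalRate, entry, hq]
  have hA : ∀ j, M.arrivalRate f x j = M.ν f * ((M.session f).reachProb j *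
      if (M.session f).kind j.1 = .active → M.engaged x < M.C then 1 else 0) := fun j =>
    M.arrivalRate_eq f j (p := fun m => (M.session f).kind m = .active → M.engaged x < M.C)
      (by rw [M.add_mem_S hx f j]; simp [hq])
  have hE : M.externalRate f x i = M.ν f * if M.entry f x = some i then 1 else 0 := by
    unfold externalRate
    split_ifs <;> simp
  simp only [hA]
  rw [hE, M.sum_routeAt f x i fun m => (M.session f).kind m = .active → M.engaged x < M.C,
    ← mul_add, sum_nextPhase]
  congr 1
  -- A phase that is not the first of its period is fed only by the preceding phase; external
  -- arrivals and completed periods lead to first phases.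
  by_cases hi : (i.2 : ℕ) = 0
  swap
  · rw [if_neg (fun h => hi (M.snd_eq_zero_of_entry h)), if_neg hi,
      Finset.sum_eq_zero fun m _ => if_neg fun h => hi (M.snd_eq_zero_of_afterPeriod h.1)]
    ring
  obtain ⟨m, rfl⟩ : ∃ m, i = (M.session f).start m :=
    ⟨i.1, Sigma.ext rfl (heq_of_eq (Fin.ext hi))⟩
  rw [if_pos hi, SessionStructure.reachProb_start, one_mul, zero_add]
  by_cases hC : M.engaged x < M.C
  · rw [M.entry_of_engaged_lt hx hq hC]
    simp only [hC, implies_true, and_true, if_true, M.afterPeriod_of_engaged_lt hx hq hC,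
      map_start_eq_some]
    refine (sum_nextPeriod m).symm.trans ?_
    congr 1
    refine if_congr ?_ rfl rfl
    rw [← Option.map_some, map_start_eq_some, Option.some_inj, eq_comm]
  -- With all resources engaged, only idle periods carry flow, each passing it to the next idle one.
  · have hC' : M.engaged x = M.C := le_antisymm ((M.mem_S x).1 hx).1 (not_lt.1 hC)
    rw [M.entry_of_engaged_eq hx hq hC']
    have hP : ∀ l, (M.afterPeriod f x l = some ((M.session f).start m) ∧
        ((M.session f).kind l = .active → M.engaged x < M.C)) ↔
        (M.session f).kind l = .idle ∧ (M.session f).nextIdle l = some m := by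
      intro l
      simp only [hC, imp_false, ← SessionStructure.kind_eq_idle]
      constructor
      · rintro ⟨h1, h2⟩
        rw [M.afterPeriod_of_engaged_eq hx hC' h2, map_start_eq_some] at h1
        exact ⟨h2, h1⟩
      · rintro ⟨h1, h2⟩
        rw [M.afterPeriod_of_engaged_eq hx hC' h1, map_start_eq_some]
        exact ⟨h2, h1⟩
    simp only [map_start_eq_some, hP]
    have hst : ((M.session f).start m).1 = m := rfl
    simp only [hst, hC, imp_false, ← SessionStructure.kind_eq_idle]
    by_cases hm : (M.session f).kind m = .idle
    · rw [if_pos hm, (M.session f).sum_last_idle m]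
      · rw [SessionStructure.nextIdle_eq_some]
        constructor
        · rintro ⟨-, -, h⟩ l hl
          by_cases h0 : l = 0
          · rw [h0, SessionStructure.kind_first]
          · exact h l (Fin.pos_iff_ne_zero.2 h0) hl
        · intro h
          refine ⟨Fin.pos_iff_ne_zero.2 ?_, hm, fun l _ => h l⟩
          rintro rfl
          rw [SessionStructure.kind_first] at hm
          cases hm
      · intro l
        rw [SessionStructure.nextIdle_eq_some]
        tauto
    · have h0 : ∀ l, (M.session f).nextIdle l ≠ some m := fun l h =>
        hm ((M.session f).nextIdle_eq_some.1 h).2.1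
      simp [h0, hm]

/-- The arrival rates that solve the traffic equations are the arrival rates under the product
form. -/
theorem arrivalFlux_productForm {x : M.State} (hx : x ∈ M.S) (f : SessionFlow K T)
    (i : (M.session f).Phase) :
    M.arrivalFlux M.productForm f x i = M.productForm x * M.arrivalRate f x i := by
  unfold arrivalFlux
  rw [M.traffic_equations hx, mul_add, Finset.mul_sum]
  simp only [M.departureFlux_productForm hx, mul_assoc]

end EGS

/-! Invariant vectors of a generator matrix on a finite set. -/

/-- The triangle inequality makes each column sum for `|d|` non-negative, because off-diagonal
entries are. Zero row sums make the total of these sums zero, so each vanishes. -/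
theorem abs_invariant {α : Type*} [DecidableEq α] (S : Finset α) (Q : α → α → ℝ) (d : α → ℝ)
    (hQ : ∀ x ∈ S, ∀ y ∈ S, x ≠ y → 0 ≤ Q x y) (hrow : ∀ x ∈ S, ∑ y ∈ S, Q x y = 0)
    (hd : ∀ y ∈ S, ∑ x ∈ S, d x * Q x y = 0) : ∀ y ∈ S, ∑ x ∈ S, |d x| * Q x y = 0 := by
  have hnn : ∀ y ∈ S, 0 ≤ ∑ x ∈ S, |d x| * Q x y := by
    intro y hy
    have hyy : Q y y ≤ 0 := by
      have := hrow y hy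
      rw [← Finset.add_sum_erase _ _ hy] at this
      have h2 : 0 ≤ ∑ x ∈ S.erase y, Q y x := Finset.sum_nonneg fun x hx =>
        hQ y hy x (Finset.mem_of_mem_erase hx) (Finset.ne_of_mem_erase hx).symm
      linarith
    have h1 := hd y hy
    rw [← Finset.add_sum_erase _ _ hy] at h1 ⊢
    have h2 : |d y * Q y y| ≤ ∑ x ∈ S.erase y, |d x| * Q x y := by
      rw [eq_neg_of_add_eq_zero_left h1, abs_neg]
      refine (Finset.abs_sum_le_sum_abs _ _).trans (Finset.sum_le_sum fun x hx => ?_)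
      rw [abs_mul, abs_of_nonneg (hQ x (Finset.mem_of_mem_erase hx) y hy
        (Finset.ne_of_mem_erase hx))]
    rw [abs_mul, abs_of_nonpos hyy] at h2
    linarith
  refine (Finset.sum_eq_zero_iff_of_nonneg hnn).1 ?_
  rw [Finset.sum_comm]
  refine Finset.sum_eq_zero fun x hx => ?_
  rw [← Finset.mul_sum, hrow x hx, mul_zero]

/-- If the state `r` can be reached from everywhere, an invariant vector that vanishes at `r`
vanishes. -/
theorem invariant_eq_zero {α : Type*} (S : Finset α) (Q : α → α → ℝ) (d : α → ℝ)
    (hQ : ∀ x ∈ S, ∀ y ∈ S, x ≠ y → 0 ≤ Q x y) (hrow : ∀ x ∈ S, ∑ y ∈ S, Q x y = 0)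
    (hd : ∀ y ∈ S, ∑ x ∈ S, d x * Q x y = 0) (r : α) (hr : d r = 0) (Φ : α → ℕ)
    (hΦ : ∀ x ∈ S, x ≠ r → ∃ y ∈ S, Φ y < Φ x ∧ 0 < Q x y) : ∀ x ∈ S, d x = 0 := by
  classical
  suffices ∀ n, ∀ x ∈ S, Φ x = n → d x = 0 from fun x hx => this _ x hx rfl
  intro n
  induction n using Nat.strong_induction_on with
  | _ n ih =>
    intro x hx hn
    by_cases hxr : x = r
    · rw [hxr, hr]
    obtain ⟨y, hy, hlt, hpos⟩ := hΦ x hx hxr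
    have hdy : d y = 0 := ih (Φ y) (hn ▸ hlt) y hy rfl
    have hxy : x ≠ y := by
      rintro rfl
      exact lt_irrefl _ hlt
    -- Since `d y = 0`, balance of `|d|` at `y` is a vanishing sum of non-negative terms; the term
    -- of `x` has the positive factor `Q x y`.
    have h := abs_invariant S Q d hQ hrow hd y hy
    have h0 : ∀ z ∈ S, 0 ≤ |d z| * Q z y := by
      intro z hz
      by_cases hzy : z = y
      · rw [hzy, hdy]
        simp
      · exact mul_nonneg (abs_nonneg _) (hQ z hz y hy hzy)
    have := (Finset.sum_eq_zero_iff_of_nonneg h0).1 h x hx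
    exact abs_eq_zero.1 ((mul_eq_zero.1 this).resolve_right hpos.ne')

namespace EGS

variable {K T : ℕ} (M : EGS K T)

/-! Transitions. -/

theorem externalRate_nonneg (f : SessionFlow K T) (z : M.State) (i : (M.session f).Phase) :
    0 ≤ M.externalRate f z i := by
  unfold externalRate
  split_ifs
  · exact M.ν_nonneg f
  · exact le_rfl

theorem routeAt_nonneg (f : SessionFlow K T) (z : M.State) (i : (M.session f).Phase)
    (j : Option (M.session f).Phase) : 0 ≤ M.routeAt f z i j := by
  have h1 := (M.session f).cont_nonneg i.1 i.2
  have h2 := (M.session f).cont_le_one i.1 i.2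
  unfold routeAt
  refine add_nonneg ?_ ?_ <;> split_ifs <;> linarith

theorem sum_routeAt_eq_one (f : SessionFlow K T) (z : M.State) (i : (M.session f).Phase) :
    ∑ j, M.routeAt f z i j = 1 := by
  simp [routeAt, Finset.sum_add_distrib]

theorem rate_nonneg (x y : M.State) : 0 ≤ M.rate x y := by
  refine add_nonneg (Finset.sum_nonneg fun f _ => Finset.sum_nonneg fun i _ => ?_)
    (Finset.sum_nonneg fun f _ => Finset.sum_nonneg fun i _ => Finset.sum_nonneg fun j _ => ?_)
  · split_ifs
    · exact M.externalRate_nonneg f x i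
    · exact le_rfl
  · split_ifs
    · exact mul_nonneg (mul_nonneg (Nat.cast_nonneg _) ((M.session f).μ_pos _ _).le)
        (M.routeAt_nonneg _ _ _ _)
    · exact le_rfl

theorem kind_of_nextIdle {s : SessionStructure} {m : s.Period} {k : s.Phase}
    (h : (s.nextIdle m).map s.start = some k) : s.kind k.1 = .idle := by
  obtain ⟨l, hl, rfl⟩ := Option.map_eq_some_iff.1 h
  exact (s.nextIdle_eq_some.1 hl).2.1

theorem add_mem_S_of_externalRate {x : M.State} (hx : x ∈ M.S) {f : SessionFlow K T}
    {i : (M.session f).Phase} (h : M.externalRate f x i ≠ 0) : x + M.e f i ∈ M.S := by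
  unfold externalRate at h
  split_ifs at h with h'
  · unfold entry at h'
    split_ifs at h' with hq hS
    · rwa [← Option.some.inj h']
    · refine (M.add_mem_S hx f i).2 ⟨hq, fun ha => ?_⟩
      rw [kind_of_nextIdle h'] at ha
      cases ha
  · exact absurd rfl h

/-- A moving session keeps its qubits, and within or after an active period it already holds a
resource. After an idle period, it enters an active one only if admissible. -/
theorem place_mem_S {z : M.State} {f : SessionFlow K T} {i : (M.session f).Phase}
    {j : Option (M.session f).Phase} (hz : z + M.e f i ∈ M.S) (h : M.routeAt f z i j ≠ 0) :
    M.place f z j ∈ M.S := by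
  have hzS := M.mem_S_of_add hz
  have hi := (M.add_mem_S hzS f i).1 hz
  cases j with
  | none => exact hzS
  | some k =>
    change z + M.e f k ∈ M.S
    unfold routeAt at h
    by_cases h1 : (M.session f).nextPhase i = some k
    · rw [M.add_mem_S hzS, ← ((M.session f).nextPhase_eq_some.1 h1).1]
      exact hi
    · rw [if_neg h1, zero_add] at h
      have h2 : M.afterPeriod f z i.1 = some k := by
        by_contra h2
        exact h (if_neg h2)
      unfold afterPeriod at h2
      cases hn : (M.session f).nextPeriod i.1 with
      | none => simp [hn] at h2
      | some n =>
        rw [hn] at h2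
        dsimp only at h2
        split_ifs at h2 with hr
        · refine (M.add_mem_S hzS f k).2 ⟨hi.1, fun ha => ?_⟩
          rw [kind_of_nextIdle h2] at ha
          cases ha
        · rw [← Option.some.inj h2]
          by_cases hk : (M.session f).kind i.1 = .active
          · exact (M.add_mem_S hzS f _).2 ⟨hi.1, fun _ => hi.2 hk⟩
          · by_contra hS
            refine hS ((M.add_mem_S hzS f _).2 ⟨hi.1, fun ha => ?_⟩)
            exact absurd ⟨(M.session f).kind_eq_idle.2 hk, ha, hS⟩ hr

theorem later_of_routeAt {z : M.State} {f : SessionFlow K T} {i k : (M.session f).Phase}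
    (h : M.routeAt f z i (some k) ≠ 0) : (M.session f).Later i k := by
  unfold routeAt at h
  by_cases h1 : (M.session f).nextPhase i = some k
  · exact (M.session f).later_of_nextPhase h1
  · rw [if_neg h1, zero_add] at h
    have h2 : M.afterPeriod f z i.1 = some k := by
      by_contra h2
      exact h (if_neg h2)
    unfold afterPeriod at h2
    cases hn : (M.session f).nextPeriod i.1 with
    | none => simp [hn] at h2
    | some n =>
      rw [hn] at h2
      dsimp only at h2
      have hlt := (M.session f).lt_of_nextPeriod hn
      split_ifs at h2
      · obtain ⟨l, hl, rfl⟩ := Option.map_eq_some_iff.1 h2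
        exact (M.session f).later_start (hlt.trans ((M.session f).nextIdle_eq_some.1 hl).1)
      · rw [← Option.some.inj h2]
        exact (M.session f).later_start hlt

open Classical in
-- The change of variables `x = z + e_i`, from the state including the moving session to the state
-- of the others.
theorem sum_shift (f : SessionFlow K T) (i : (M.session f).Phase) (H : M.State → ℝ) :
    ∑ x ∈ M.S, (if x f i = 0 then 0 else H x) =
      ∑ z ∈ M.S, if z + M.e f i ∈ M.S then H (z + M.e f i) else 0 := by
  simp only [← ite_not (p := _ = 0)]
  rw [← Finset.sum_filter, ← Finset.sum_filter]
  refine Finset.sum_nbij' (fun x => x - M.e f i) (fun z => z + M.e f i) ?_ ?_ ?_ ?_ ?_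
  · intro x hx
    rw [Finset.mem_filter] at hx ⊢
    exact ⟨M.sub_e_mem_S hx.1 hx.2, by rw [M.sub_add_e hx.2]; exact hx.1⟩
  · intro z hz
    rw [Finset.mem_filter] at hz ⊢
    refine ⟨hz.2, ?_⟩
    simp only [Pi.add_apply, e_apply_self]
    omega
  · intro x hx
    exact M.sub_add_e (Finset.mem_filter.1 hx).2
  · intro z _
    exact M.add_sub_e z f i
  · intro x hx
    rw [M.sub_add_e (Finset.mem_filter.1 hx).2]

/-! Stationarity of the product form. -/

open Classical in
theorem sum_rate {y : M.State} (hy : y ∈ M.S) :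
    ∑ z ∈ M.S, M.rate y z =
      ∑ f, ∑ i, M.externalRate f y i + ∑ f, ∑ i, (y f i : ℝ) * (M.session f).μ i.1 i.2 := by
  unfold rate
  rw [Finset.sum_add_distrib, Finset.sum_comm, Finset.sum_comm]
  congr 1
  · rw [Finset.sum_comm]
    refine Finset.sum_congr rfl fun f _ => ?_
    rw [Finset.sum_comm]
    refine Finset.sum_congr rfl fun i _ => ?_
    rw [Finset.sum_ite_eq]
    split_ifs with h
    · rfl
    · by_contra h'
      exact h (M.add_mem_S_of_externalRate hy (Ne.symm h'))
  · rw [Finset.sum_comm]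
    refine Finset.sum_congr rfl fun f _ => ?_
    rw [Finset.sum_comm]
    refine Finset.sum_congr rfl fun i _ => ?_
    rw [Finset.sum_comm]
    trans ∑ j, (y f i : ℝ) * (M.session f).μ i.1 i.2 * M.routeAt f (y - M.e f i) i j
    swap
    · rw [← Finset.mul_sum, M.sum_routeAt_eq_one, mul_one]
    refine Finset.sum_congr rfl fun j _ => ?_
    rw [Finset.sum_ite_eq]
    split_ifs with h
    · rfl
    · by_contra h'
      have h1 := right_ne_zero_of_mul (Ne.symm h')
      have h2 : y f i ≠ 0 := fun h0 => h' (by simp [h0])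
      exact h (M.place_mem_S (by rwa [M.sub_add_e h2]) h1)

open Classical in
-- Sorts the inflow into `y` by the last event: a session arrived in phase `i`, from outside or from
-- another phase, or a session ended.
theorem sum_mul_rate (π : M.State → ℝ) (hπ : ∀ x, x ∉ M.S → π x = 0) (y : M.State) (hy : y ∈ M.S) :
    ∑ x ∈ M.S, π x * M.rate x y =
      (∑ f, ∑ i, ∑ z ∈ M.S, if z + M.e f i = y then M.arrivalFlux π f z i else 0) +
        ∑ f, ∑ i, M.departureFlux π f y i * M.routeAt f y i none := by
  have key : ∀ (f : SessionFlow K T) (i : (M.session f).Phase) (j : Option (M.session f).Phase),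
      ∑ x ∈ M.S, π x * (if M.place f (x - M.e f i) j = y then
        (x f i : ℝ) * (M.session f).μ i.1 i.2 * M.routeAt f (x - M.e f i) i j else 0) =
      ∑ z ∈ M.S, if M.place f z j = y then
        M.departureFlux π f z i * M.routeAt f z i j else 0 := by
    intro f i j
    have := M.sum_shift f i fun x => π x * (if M.place f (x - M.e f i) j = y then
        (x f i : ℝ) * (M.session f).μ i.1 i.2 * M.routeAt f (x - M.e f i) i j else 0)
    -- The factor `x f i` removes the states without a session in phase `i`, where the truncated
    -- subtraction `x - e_i` would be meaningless.
    refine Eq.trans (Finset.sum_congr rfl fun x _ => ?_) (this.trans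
      (Finset.sum_congr rfl fun z _ => ?_))
    · split_ifs with h1 h2 h2
      all_goals simp_all
    · rw [M.add_sub_e]
      unfold departureFlux
      by_cases h : z + M.e f i ∈ M.S
      · rw [if_pos h]
        simp only [Pi.add_apply, e_apply_self]
        split_ifs <;> ring
      · rw [if_neg h, hπ _ h]
        simp
  have lhs : ∑ x ∈ M.S, π x * M.rate x y =
      (∑ f, ∑ i, ∑ z ∈ M.S, if z + M.e f i = y then π z * M.externalRate f z i else 0) +
        ∑ f, ∑ i, ∑ j, ∑ z ∈ M.S, if M.place f z j = y then
          M.departureFlux π f z i * M.routeAt f z i j else 0 := by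
    simp only [← key]
    unfold rate
    simp only [mul_add, Finset.sum_add_distrib, Finset.mul_sum]
    congr 1
    · rw [Finset.sum_comm]
      refine Finset.sum_congr rfl fun f _ => ?_
      rw [Finset.sum_comm]
      simp only [mul_ite, mul_zero]
    · rw [Finset.sum_comm]
      refine Finset.sum_congr rfl fun f _ => ?_
      rw [Finset.sum_comm]
      refine Finset.sum_congr rfl fun i _ => ?_
      rw [Finset.sum_comm]
  have hnone : ∀ (f : SessionFlow K T) (i : (M.session f).Phase),
      (∑ z ∈ M.S, if M.place f z none = y then
        M.departureFlux π f z i * M.routeAt f z i none else 0) =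
      M.departureFlux π f y i * M.routeAt f y i none := by
    intro f i
    refine (Finset.sum_eq_single y (fun z _ hne => ?_) (fun h => absurd hy h)).trans ?_
    · exact if_neg hne
    · exact if_pos rfl
  rw [lhs]
  simp only [Fintype.sum_option, hnone, Finset.sum_add_distrib]
  rw [add_comm (∑ f, ∑ i, M.departureFlux π f y i * M.routeAt f y i none), ← add_assoc]
  congr 1
  rw [← Finset.sum_add_distrib]
  refine Finset.sum_congr rfl fun f _ => ?_
  rw [Finset.sum_comm (s := Finset.univ) (t := Finset.univ), ← Finset.sum_add_distrib]
  refine Finset.sum_congr rfl fun i _ => ?_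
  rw [Finset.sum_comm, ← Finset.sum_add_distrib]
  refine Finset.sum_congr rfl fun z _ => ?_
  by_cases h : z + M.e f i = y
  · rw [if_pos h, if_pos h, arrivalFlux]
    exact congrArg _ (Finset.sum_congr rfl fun j _ => if_pos h)
  · rw [if_neg h, if_neg h, zero_add]
    exact Finset.sum_eq_zero fun j _ => if_neg h

/-- Sessions leave the network at the rate at which they enter it. -/
theorem sum_externalRate {x : M.State} (hx : x ∈ M.S) (f : SessionFlow K T) :
    ∑ i, M.externalRate f x i = ∑ i, M.arrivalRate f x i * M.routeAt f x i none := by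
  have h : ∑ i, M.arrivalRate f x i = ∑ i, M.externalRate f x i +
      ∑ j, ∑ i, M.arrivalRate f x j * M.routeAt f x j (some i) := by
    rw [Finset.sum_comm, ← Finset.sum_add_distrib]
    exact Finset.sum_congr rfl fun i _ => M.traffic_equations hx f i
  -- The routing probabilities, exit included, sum to one; comparison with the summed traffic
  -- equations leaves only entries and exits.
  have h' : ∑ i, M.arrivalRate f x i = ∑ j, (M.arrivalRate f x j * M.routeAt f x j none +
      ∑ i, M.arrivalRate f x j * M.routeAt f x j (some i)) := by
    refine Finset.sum_congr rfl fun j _ => ?_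
    rw [← Finset.mul_sum, ← mul_add, ← Fintype.sum_option, M.sum_routeAt_eq_one, mul_one]
  rw [Finset.sum_add_distrib] at h'
  linarith

open Classical in
theorem productForm_global_balance {y : M.State} (hy : y ∈ M.S) :
    ∑ x ∈ M.S, M.productForm x * M.rate x y = M.productForm y * ∑ z ∈ M.S, M.rate y z := by
  rw [M.sum_mul_rate _ (fun x => M.productForm_of_not_mem) y hy, M.sum_rate hy, add_comm, mul_add]
  congr 1
  · rw [Finset.mul_sum]
    refine Finset.sum_congr rfl fun f _ => ?_
    rw [M.sum_externalRate hy, Finset.mul_sum]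
    exact Finset.sum_congr rfl fun i _ => by rw [M.departureFlux_productForm hy, mul_assoc]
  · rw [Finset.mul_sum]
    refine Finset.sum_congr rfl fun f _ => ?_
    rw [Finset.mul_sum]
    refine Finset.sum_congr rfl fun i _ => ?_
    have := M.sum_shift f i fun x =>
      if x = y then M.productForm x * (x f i * (M.session f).μ i.1 i.2) else 0
    refine Eq.trans (Finset.sum_congr rfl fun z hz => ?_) (this.symm.trans ?_)
    · rw [M.arrivalFlux_productForm hz, ← M.departureFlux_productForm hz]
      unfold departureFlux
      by_cases h : z + M.e f i ∈ M.S
      · rw [if_pos h]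
        simp only [Pi.add_apply, e_apply_self, mul_assoc]
      · rw [if_neg h, if_neg]
        rintro rfl
        exact h hy
    · rw [Finset.sum_eq_single y]
      · by_cases h : y f i = 0
        · simp [h]
        · rw [if_neg h, if_pos rfl]
      · intro x _ hne
        simp [hne]
      · exact fun h => absurd hy h

theorem sum_generator {x : M.State} (hx : x ∈ M.S) : ∑ y ∈ M.S, M.generator x y = 0 := by
  classical
  rw [← Finset.add_sum_erase _ _ hx, generator, if_pos rfl, neg_add_eq_zero]
  refine Finset.sum_congr (by congr!) fun y hy => ?_
  rw [generator, if_neg (Finset.ne_of_mem_erase hy).symm]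

theorem isStationary_productForm : M.IsStationary M.productForm where
  nonneg := M.productForm_nonneg
  zero_outside _ := M.productForm_of_not_mem
  sum_one := M.sum_productForm
  balance y hy := by
    classical
    have h := M.productForm_global_balance hy
    -- The diagonal term `rate y y`, which the generator omits, cancels from both sides.
    rw [← Finset.add_sum_erase _ _ hy, ← Finset.add_sum_erase M.S (M.rate y) hy, mul_add,
      add_right_inj] at h
    rw [← Finset.add_sum_erase _ _ hy, generator, if_pos rfl, mul_neg, neg_add_eq_zero]
    refine Eq.trans ?_ (h.symm.trans (Finset.sum_congr rfl fun x hx => ?_))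
    · congr!
    · rw [generator, if_neg (Finset.ne_of_mem_erase hx)]

/-! Uniqueness. -/

/-- An upper bound for the number of transitions until all present sessions have ended. -/
noncomputable def remaining (x : M.State) : ℕ :=
  ∑ f, ∑ i, x f i • ((M.session f).rank i + 1)

theorem remaining_add_e (z : M.State) (f : SessionFlow K T) (i : (M.session f).Phase) :
    M.remaining (z + M.e f i) = M.remaining z + ((M.session f).rank i + 1) := by
  rw [← M.sum_e f i fun g j => (M.session g).rank j + 1]
  unfold remaining
  simp only [Pi.add_apply, add_smul, Finset.sum_add_distrib]

/-- Any possible move of a present session leads to a later phase or out of the network. No arrivals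
are used, so some or all `ν` may vanish. -/
theorem exists_transition {x : M.State} (hx : x ∈ M.S) (h0 : x ≠ 0) :
    ∃ y ∈ M.S, M.remaining y < M.remaining x ∧ 0 < M.generator x y := by
  classical
  obtain ⟨f, i, hi⟩ : ∃ f i, x f i ≠ 0 := by
    by_contra! h
    exact h0 (funext fun f => funext fun i => h f i)
  obtain ⟨j, hj⟩ : ∃ j, M.routeAt f (x - M.e f i) i j ≠ 0 := by
    by_contra! h
    have := M.sum_routeAt_eq_one f (x - M.e f i) i
    simp [h] at this
  have hlt : M.remaining (M.place f (x - M.e f i) j) < M.remaining x := by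
    conv_rhs => rw [← M.sub_add_e hi, remaining_add_e]
    cases j with
    | none => simp only [place]; omega
    | some k =>
      have := (M.session f).rank_lt (M.later_of_routeAt hj)
      simp only [place, remaining_add_e]
      omega
  refine ⟨_, M.place_mem_S (by rwa [M.sub_add_e hi]) hj, hlt, ?_⟩
  rw [generator, if_neg (fun h => hlt.ne (by rw [← h]))]
  have hpos : 0 < (x f i : ℝ) * (M.session f).μ i.1 i.2 * M.routeAt f (x - M.e f i) i j :=
    mul_pos (mul_pos (Nat.cast_pos.2 (Nat.pos_of_ne_zero hi)) ((M.session f).μ_pos _ _))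
      (lt_of_le_of_ne (M.routeAt_nonneg _ _ _ _) hj.symm)
  have hterm : ∀ (g : SessionFlow K T) (k : (M.session g).Phase) (l : Option (M.session g).Phase)
      (y : M.State), 0 ≤ if M.place g (x - M.e g k) l = y then
        (x g k : ℝ) * (M.session g).μ k.1 k.2 * M.routeAt g (x - M.e g k) k l else 0 := by
    intro g k l y
    split_ifs
    · exact mul_nonneg (mul_nonneg (Nat.cast_nonneg _) ((M.session g).μ_pos _ _).le)
        (M.routeAt_nonneg _ _ _ _)
    · exact le_rfl
  refine add_pos_of_nonneg_of_pos (Finset.sum_nonneg fun g _ => Finset.sum_nonneg fun k _ => ?_) ?_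
  · split_ifs
    · exact M.externalRate_nonneg g x k
    · exact le_rfl
  · refine Finset.sum_pos' (fun g _ => Finset.sum_nonneg fun k _ => Finset.sum_nonneg fun l _ =>
      hterm g k l _) ⟨f, Finset.mem_univ _, ?_⟩
    refine Finset.sum_pos' (fun k _ => Finset.sum_nonneg fun l _ => hterm f k l _)
      ⟨i, Finset.mem_univ _, ?_⟩
    refine Finset.sum_pos' (fun l _ => hterm f i l _) ⟨j, Finset.mem_univ _, ?_⟩
    rwa [if_pos rfl]

/-- The combination of the two distributions that vanishes at the empty state is invariant, hence
zero; normalization then makes their values there agree. -/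
theorem IsStationary.eq_productForm {π : M.State → ℝ} (h : M.IsStationary π) :
    π = M.productForm := by
  have hp := M.isStationary_productForm
  have hd := invariant_eq_zero M.S M.generator
    (fun x => π x * M.productForm 0 - M.productForm x * π 0)
    (fun x _ y _ hne => by rw [generator, if_neg hne]; exact M.rate_nonneg x y)
    (fun x hx => M.sum_generator hx)
    (fun y hy => by
      have h1 := h.balance y hy
      have h2 := hp.balance y hy
      have : ∀ x, (π x * M.productForm 0 - M.productForm x * π 0) * M.generator x y =
          M.productForm 0 * (π x * M.generator x y) -
            π 0 * (M.productForm x * M.generator x y) := fun x => by ring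
      simp only [this]
      rw [Finset.sum_sub_distrib, ← Finset.mul_sum, ← Finset.mul_sum, h1, h2]
      ring)
    0 (by ring) M.remaining (fun x hx h0 => M.exists_transition hx h0)
  have hsum := Finset.sum_eq_zero hd
  rw [Finset.sum_sub_distrib, ← Finset.sum_mul, ← Finset.sum_mul, h.sum_one, hp.sum_one] at hsum
  funext x
  by_cases hx : x ∈ M.S
  · have h1 := hd x hx
    have h2 := M.productForm_zero_pos
    have h3 : π 0 = M.productForm 0 := by linarith
    rw [h3, ← sub_mul] at h1
    exact sub_eq_zero.1 ((mul_eq_zero.1 h1).resolve_right h2.ne')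
  · rw [h.zero_outside x hx, hp.zero_outside x hx]

theorem isStationary_iff (π : M.State → ℝ) : M.IsStationary π ↔ π = M.productForm :=
  ⟨fun h => h.eq_productForm, fun h => h ▸ M.isStationary_productForm⟩

end EGS

/-! ### Lumping by the multinomial theorem -/

/-- A product of powers of sums, over the fibres of `p`, by the multinomial theorem. -/
theorem prod_pow_sum_fiber {ι J : Type*} [Fintype ι] [DecidableEq ι] [Fintype J] [DecidableEq J]
    (p : ι → J) (ρ : ι → ℝ) (q : J → ℕ) (A : Finset (ι → ℕ))
    (hA : ∀ x, x ∈ A ↔ ∀ j, ∑ i with p i = j, x i = q j) :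
    ∏ j, (∑ i with p i = j, ρ i) ^ q j / (q j).factorial =
      ∑ x ∈ A, ∏ i, ρ i ^ x i / (x i).factorial := by
  have h1 : ∀ j, (∑ i with p i = j, ρ i) ^ q j / (q j).factorial =
      ∑ k ∈ Finset.piAntidiag (Finset.univ.filter fun i => p i = j) (q j),
        ∏ i with p i = j, ρ i ^ k i / (k i).factorial := by
    intro j
    rw [Finset.sum_pow_eq_sum_piAntidiag, Finset.sum_div]
    refine Finset.sum_congr rfl fun k hk => ?_
    rw [Finset.mem_piAntidiag] at hk
    have hs := Nat.multinomial_spec (Finset.univ.filter fun i => p i = j) k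
    rw [hk.1] at hs
    rw [Finset.prod_div_distrib, ← hs]
    have hpos : (Nat.multinomial (Finset.univ.filter fun i => p i = j) k : ℝ) ≠ 0 :=
      Nat.cast_ne_zero.2 (Nat.multinomial_pos _ _).ne'
    push_cast
    rw [mul_comm (∏ i with p i = j, ((k i).factorial : ℝ)), mul_div_mul_left _ _ hpos]
  simp only [h1]
  rw [Finset.prod_univ_sum]
  -- Families of vectors, one per fibre and zero off that fibre, are glued to a single vector; the
  -- inverse restricts it to the fibres.
  refine Finset.sum_nbij' (fun Y i => Y (p i) i) (fun x j i => if p i = j then x i else 0)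
    ?_ ?_ ?_ ?_ ?_
  · intro Y hY
    rw [Fintype.mem_piFinset] at hY
    rw [hA]
    intro j
    rw [← (Finset.mem_piAntidiag.1 (hY j)).1]
    refine Finset.sum_congr rfl fun i hi => ?_
    rw [(Finset.mem_filter.1 hi).2]
  · intro x hx
    rw [hA] at hx
    rw [Fintype.mem_piFinset]
    intro j
    rw [Finset.mem_piAntidiag]
    refine ⟨?_, fun i hi => ?_⟩
    · rw [← hx j]
      refine Finset.sum_congr rfl fun i hi => ?_
      rw [if_pos (Finset.mem_filter.1 hi).2]
    · by_contra h
      exact hi (if_neg fun h' => h (by simp [h']))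
  · intro Y hY
    rw [Fintype.mem_piFinset] at hY
    funext j i
    split_ifs with h
    · subst h
      rfl
    · by_contra h'
      have := (Finset.mem_piAntidiag.1 (hY j)).2 i (Ne.symm h')
      exact h (Finset.mem_filter.1 this).2
  · intro x _
    funext i
    simp
  · intro Y hY
    rw [← Finset.prod_fiberwise Finset.univ p]
    refine Finset.prod_congr rfl fun j _ => Finset.prod_congr rfl fun i hi => ?_
    obtain rfl := (Finset.mem_filter.1 hi).2
    rfl

namespace EGS

variable {K T : ℕ} (M : EGS K T)

/-! Blocking. -/

open Classical in
theorem admittedRate_productForm (f : SessionFlow K T) {m : (M.session f).Period}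
    (hm : (M.session f).kind m = .active) :
    M.admittedRate M.productForm f m =
      M.ν f * ∑ x ∈ M.S with M.HasQubits f x ∧ M.engaged x < M.C, M.productForm x := by
  unfold admittedRate
  rw [Finset.sum_filter, Finset.mul_sum]
  refine Finset.sum_congr rfl fun z hz => ?_
  have h : z + M.e f ((M.session f).start m) ∈ M.S ↔ M.HasQubits f z ∧ M.engaged z < M.C := by
    rw [M.add_mem_S hz]
    simp [SessionStructure.start, hm]
  rw [M.arrivalFlux_productForm hz, arrivalRate, if_congr h rfl rfl,
    SessionStructure.reachProb_start]
  split_ifs <;> ring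

open Classical in
-- In each state with free qubits and no free resource, the jumps over `m` come from a single
-- source: the last idle period before `m`, or else the beginning of the session. Either has rate
-- `ν`.
theorem blockedRate_productForm (f : SessionFlow K T) {m : (M.session f).Period}
    (hm : (M.session f).kind m = .active) :
    M.blockedRate M.productForm f m =
      M.ν f * ∑ x ∈ M.S with M.HasQubits f x ∧ M.engaged x = M.C, M.productForm x := by
  unfold blockedRate
  rw [Finset.sum_filter, Finset.mul_sum]
  refine Finset.sum_congr rfl fun z hz => ?_
  simp only [M.departureFlux_productForm hz]
  by_cases hq : M.HasQubits f z
  swap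
  · have hA : ∀ j, M.arrivalRate f z j = 0 := fun j =>
      if_neg fun h => hq ((M.add_mem_S hz f j).1 h).1
    simp [hq, hA]
  by_cases hC : M.engaged z = M.C
  swap
  · have hlt : M.engaged z < M.C := lt_of_le_of_ne ((M.mem_S z).1 hz).1 hC
    have hS : ∀ i, z + M.e f i ∈ M.S := fun i => (M.add_mem_S hz f i).2 ⟨hq, fun _ => hlt⟩
    simp [Refused, hS, hC]
  set P : (M.session f).Period → Prop := fun l => ∃ n, (M.session f).nextPeriod l = some n ∧
    M.Refused f z l n ∧ (M.session f).ActiveRun n m with hPdef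
  have hP : ∀ l, P l ↔ l < m ∧ (M.session f).kind l = .idle ∧
      ∀ l', l < l' → l' < m → (M.session f).kind l' = .active := by
    intro l
    constructor
    · rintro ⟨n, hn, hr, hle, hact⟩
      rw [SessionStructure.nextPeriod_eq_some] at hn
      rw [Fin.le_def] at hle
      refine ⟨Fin.lt_def.2 (by omega), hr.1, fun l' h1 h2 => hact l' ?_ h2.le⟩
      rw [Fin.lt_def] at h1
      exact Fin.le_def.2 (by omega)
    · rintro ⟨hlt, hi, hact⟩
      have hlt' := Fin.lt_def.1 hlt
      obtain ⟨n, hn⟩ : ∃ n, (M.session f).nextPeriod l = some n := by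
        refine Option.ne_none_iff_exists'.1 fun h' => ?_
        rw [SessionStructure.nextPeriod_eq_none] at h'
        exact absurd (h' ▸ hlt) (not_lt.2 (Fin.le_last _))
      have hn' := (M.session f).nextPeriod_eq_some.1 hn
      have hrun : (M.session f).ActiveRun n m := by
        refine ⟨Fin.le_def.2 (by omega), fun l' h1 h2 => ?_⟩
        rcases h2.lt_or_eq with h2 | rfl
        · refine hact l' (Fin.lt_def.2 ?_) h2
          rw [Fin.le_def] at h1
          omega
        · exact hm
      have hk := hrun.2 n le_rfl hrun.1
      refine ⟨n, hn, ⟨hi, hk, fun h => ?_⟩, hrun⟩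
      have := ((M.add_mem_S hz f _).1 h).2 hk
      omega
  have hrun0 : (M.session f).ActiveRun 0 m ↔ ∀ l < m, (M.session f).kind l = .active := by
    refine ⟨fun h l hl => h.2 l (Fin.zero_le _) hl.le, fun h => ⟨Fin.zero_le _, fun l _ hl => ?_⟩⟩
    rcases hl.lt_or_eq with hl | rfl
    · exact h l hl
    · exact hm
  have hsum : (∑ j : (M.session f).Phase, if P j.1 then
      M.productForm z * M.arrivalRate f z j * (1 - (M.session f).cont j.1 j.2) else 0) =
      M.productForm z * M.ν f * ∑ l, if P l then 1 else 0 := by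
    rw [← (M.session f).sum_reachProb_mul, Finset.mul_sum]
    refine Finset.sum_congr rfl fun j _ => ?_
    split_ifs with h
    · have hj : z + M.e f j ∈ M.S := by
        refine (M.add_mem_S hz f j).2 ⟨hq, fun ha => ?_⟩
        rw [((hP _).1 h).2.1] at ha
        cases ha
      rw [arrivalRate, if_pos hj]
      ring
    · ring
  rw [hsum, if_pos (⟨hq, hC⟩ : _ ∧ _)]
  have hone := (M.session f).sum_last_idle m ((M.session f).ActiveRun 0 m) P hrun0 hP
  simp only [hq, M.start_zero_not_mem hz f hC, not_false_eq_true, true_and]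
  split_ifs with hR
  · rw [if_pos hR] at hone
    linear_combination M.productForm z * M.ν f * hone
  · rw [if_neg hR] at hone
    linear_combination M.productForm z * M.ν f * hone

theorem hasQubits_zero {f : SessionFlow K T} (hc : ∀ k, f.Uses k → 0 < M.c k) :
    M.HasQubits f 0 := fun k hk => by
  have : M.qubits 0 k = 0 := by simp [qubits]
  rw [this]
  exact hc k hk

open Classical in
theorem sum_hasQubits_pos {f : SessionFlow K T} (hc : ∀ k, f.Uses k → 0 < M.c k) :
    0 < ∑ x ∈ M.S with M.HasQubits f x, M.productForm x :=
  Finset.sum_pos' (fun x _ => M.productForm_nonneg x)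
    ⟨0, Finset.mem_filter.2 ⟨M.zero_mem_S, M.hasQubits_zero hc⟩, M.productForm_zero_pos⟩

open Classical in
theorem blockedRate_add_admittedRate (f : SessionFlow K T) {m : (M.session f).Period}
    (hm : (M.session f).kind m = .active) :
    M.blockedRate M.productForm f m + M.admittedRate M.productForm f m =
      M.ν f * ∑ x ∈ M.S with M.HasQubits f x, M.productForm x := by
  rw [M.blockedRate_productForm f hm, M.admittedRate_productForm f hm, ← mul_add]
  simp only [Finset.sum_filter]
  rw [← Finset.sum_add_distrib]
  congr 1
  refine Finset.sum_congr rfl fun x hx => ?_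
  have := ((M.mem_S x).1 hx).1
  by_cases hq : M.HasQubits f x
  · rcases this.lt_or_eq with h | h
    · simp [hq, h, h.ne]
    · simp [hq, h]
  · simp [hq]

theorem blockingProb_productForm {f : SessionFlow K T} (hν : 0 < M.ν f)
    {m : (M.session f).Period} (hm : (M.session f).kind m = .active) :
    M.blockingProb M.productForm f m = M.probAllEngaged M.productForm f := by
  classical
  unfold blockingProb
  rw [M.blockedRate_add_admittedRate f hm, M.blockedRate_productForm f hm,
    mul_div_mul_left _ _ hν.ne', div_eq_inv_mul]
  rfl

/-! Occupancies. -/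

/-- The numbers of sessions of each flow in active and in idle periods. -/
def occupancy (x : M.State) (j : SessionFlow K T × PeriodKind) : ℕ :=
  ∑ i : (M.session j.1).Phase, if (M.session j.1).kind i.1 = j.2 then x j.1 i else 0

theorem engaged_eq_occupancy (x : M.State) :
    M.engaged x = ∑ g, M.occupancy x (g, .active) := rfl

theorem sum_eq_occupancy (x : M.State) (g : SessionFlow K T) :
    ∑ i, x g i = M.occupancy x (g, .active) + M.occupancy x (g, .idle) := by
  unfold occupancy
  rw [← Finset.sum_add_distrib]
  refine Finset.sum_congr rfl fun i _ => ?_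
  dsimp only
  cases (M.session g).kind i.1 <;> simp

theorem qubits_eq_occupancy (x : M.State) (k : Fin K) :
    M.qubits x k = ∑ g : SessionFlow K T,
      if g.Uses k then M.occupancy x (g, .active) + M.occupancy x (g, .idle) else 0 := by
  unfold qubits
  simp only [sum_eq_occupancy]

/-- Lumping is possible because all limits see a state only through its occupancy. -/
theorem occupancy_mem (f : SessionFlow K T) (x : M.State) :
    M.occupancy x ∈ M.occupancies f ↔ x ∈ M.S ∧ M.HasQubits f x := by
  rw [occupancies, Set.Finite.mem_toFinset, occupancySet, Set.mem_ofPred_eq, mem_S,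
    engaged_eq_occupancy, HasQubits]
  simp only [qubits_eq_occupancy, forall_and, and_assoc]

theorem sum_sigma_fiber {A : Type*} [AddCommMonoid A]
    (w : (g : SessionFlow K T) → (M.session g).Phase → A) (j : SessionFlow K T × PeriodKind) :
    ∑ p : (g : SessionFlow K T) × (M.session g).Phase with
        (p.1, (M.session p.1).kind p.2.1) = j, w p.1 p.2 =
      ∑ i : (M.session j.1).Phase, if (M.session j.1).kind i.1 = j.2 then w j.1 i else 0 := by
  obtain ⟨g, a⟩ := j
  rw [Finset.sum_filter, Fintype.sum_sigma, Finset.sum_eq_single g]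
  · simp
  · intro g' _ hne
    simp [hne]
  · simp

theorem sum_weight_fiber (q : SessionFlow K T × PeriodKind → ℕ) (A : Finset M.State)
    (hA : ∀ x, x ∈ A ↔ M.occupancy x = q) : ∑ x ∈ A, M.weight x = M.occupancyWeight q := by
  classical
  have h := prod_pow_sum_fiber
    (fun p : (g : SessionFlow K T) × (M.session g).Phase => (p.1, (M.session p.1).kind p.2.1))
    (fun p => M.ρ p.1 p.2) q (A.map (Equiv.piCurry fun _ _ => ℕ).symm.toEmbedding) (by
      intro x
      rw [Finset.mem_map_equiv, Equiv.symm_symm, hA, funext_iff]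
      refine forall_congr' fun j => ?_
      exact Eq.congr (M.sum_sigma_fiber (fun g i => x ⟨g, i⟩) j).symm rfl)
  rw [Finset.sum_map] at h
  unfold occupancyWeight intensity weight
  refine Eq.trans (Finset.sum_congr rfl fun x _ => ?_) (h.symm.trans ?_)
  · rw [Fintype.prod_sigma]
    rfl
  · refine Finset.prod_congr rfl fun j _ => ?_
    rw [M.sum_sigma_fiber]

open Classical in
theorem sum_weight_eq (B : Finset (SessionFlow K T × PeriodKind → ℕ))
    (A : Finset M.State) (hA : ∀ x, x ∈ A ↔ M.occupancy x ∈ B) :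
    ∑ x ∈ A, M.weight x = ∑ q ∈ B, M.occupancyWeight q := by
  rw [← Finset.sum_fiberwise_of_maps_to (fun x hx => (hA x).1 hx)]
  refine Finset.sum_congr rfl fun q hq => M.sum_weight_fiber q _ fun x => ?_
  rw [Finset.mem_filter, hA, and_iff_right_iff_imp]
  rintro rfl
  exact hq

theorem probAllEngaged_productForm (f : SessionFlow K T) :
    M.probAllEngaged M.productForm f = M.blockingFormula f := by
  classical
  have hS : ∀ (p : M.State → Prop) [DecidablePred p], ∑ x ∈ M.S with p x, M.productForm x =
      (∑ y ∈ M.S, M.weight y)⁻¹ * ∑ x ∈ M.S with p x, M.weight x := by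
    intro p _
    rw [Finset.mul_sum]
    exact Finset.sum_congr rfl fun x hx => M.productForm_of_mem (Finset.mem_filter.1 hx).1
  unfold probAllEngaged blockingFormula
  -- The normalization constant cancels from the conditional probability.
  rw [hS, hS, mul_inv, mul_mul_mul_comm, inv_mul_cancel₀ (inv_ne_zero M.sum_weight_pos.ne'),
    one_mul]
  refine congrArg₂ (fun a b => a⁻¹ * b) ?_ ?_
  · refine M.sum_weight_eq _ _ fun x => ?_
    rw [occupancy_mem, Finset.mem_filter]
  · refine M.sum_weight_eq _ _ fun x => ?_
    rw [Finset.mem_filter, Finset.mem_filter, occupancy_mem, engaged_eq_occupancy, and_assoc]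

end EGS
theorem mainTheorem5 {K T : ℕ} (M : EGS K T) :
    -- the product form is the unique stationary distribution
    (∀ π : M.State → ℝ, M.IsStationary π ↔ π = M.productForm) ∧
    -- the state-independent arrival rates solve the traffic equations
    (∀ x ∈ M.S, ∀ f i, M.arrivalRate f x i =
      M.externalRate f x i + ∑ j, M.arrivalRate f x j * M.routeAt f x j (some i)) ∧
    -- and they are the arrival rates of the stationary chain
    (∀ π : M.State → ℝ, M.IsStationary π → ∀ x ∈ M.S, ∀ f i,
      M.arrivalFlux π f x i = π x * M.arrivalRate f x i) ∧
    -- blocking of an arbitrary active period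
    (∀ π : M.State → ℝ, M.IsStationary π → ∀ f : SessionFlow K T, 0 < M.ν f →
      (∀ k, f.Uses k → 0 < M.c k) →
      ∀ m : (M.session f).Period, (M.session f).kind m = .active →
        0 < M.blockedRate π f m + M.admittedRate π f m ∧
        M.blockingProb π f m = M.probAllEngaged π f ∧
        M.blockingProb π f m = M.blockingFormula f) := by

  refine ⟨M.isStationary_iff, fun x hx f i => M.traffic_equations hx f i, ?_, ?_⟩
  · intro π hπ x hx f i
    rw [hπ.eq_productForm]
    exact M.arrivalFlux_productForm hx f i
  · intro π hπ f hν hc m hm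
    rw [hπ.eq_productForm, M.blockedRate_add_admittedRate f hm, M.blockingProb_productForm hν hm]
    exact ⟨mul_pos hν (M.sum_hasQubits_pos hc), rfl, M.probAllEngaged_productForm f⟩
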